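/- Let $\mathcal H$ be a complex Hilbert space with orthonormal basis $\{e_k\}_{k\ge 1}$; matrices are taken with respect to this basis, $c_1(T)$ denotes the first column of $T$, $P_n$ is the orthogonal projection onto $\mathrm{span}\{e_1,\dots,e_n\}$, and $[S,T]=ST-TS$. Let $A$ be a compact operator with $A=ubu^*$, where $u$ is unitary, $u-1$ is compact, $b=\mathrm{Diag}(\lambda_1,\lambda_2,\dots)$ with $\lambda_i\in\mathbb R$ and $\lambda_i\ne\lambda_j$ for $i\neq j$. Let $\mathcal O_A=\{wAw^*: w \text{ unitary},\ w-1\text{ compact}\}$, with tangent spaces $(T\mathcal O_A)_c=\{[z,c]: z \text{ compact},\ z^*=-z\}$, Finsler norm $\|x\|_c=\inf\{\|z\|: z\text{ compact},\ z^*=-z,\ [z,c]=x\}$, and length $\mathrm L(\beta)=\int\|\beta'(t)\|_{\beta(t)}\,dt$. A curve in $\mathcal O_A$ is called minimal if its length is the infimum of the lengths of all $C^1$ curves in $\mathcal O_A$ with the same endpoints. Let $\gamma\in\mathbb R$, $0<|\gamma|<1$. Let $L$ be $i$ times the matrix whose first row and first column are $(0,\gamma,\gamma^2,\dots)$ and whose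 other entries vanish. Let $Y^{[1]}$ be $i$ times the symmetric matrix with zero first row, zero first column, zero diagonal, and entry $\gamma^{k-2}$ at $(j,k)$ for $2\le j<k$. Let $D_0=i\,\mathrm{Diag}(d_k)$ and $D_n=i\,\mathrm{Diag}(d^{(n)}_k)$, where $d_1=d_1^{(n)}=0$, $d^{(n)}_k=0$ for $k>n$, and $$d_k=-\frac{1-\gamma^{k-2}}{1-\gamma}-\frac{\gamma^k}{1-\gamma^2}\quad(k\ge2),\qquad d^{(n)}_k=-\sum_{j=0}^{k-3}\gamma^j-\sum_{j=k}^{n-1}\gamma^{2j-k}\quad(2\le k\le n).$$ Put $M_0=\max\{\sup_n\|P_nY^{[1]}P_n+D_n\|,\ \|Y^{[1]}+D_0\|\}$, which is finite and positive, and $$Y_r=\tfrac{M_0}{\|c_1(L)\|}L+Y^{[1]},\qquad Y_n=\tfrac{M_0}{\|c_1(P_nLP_n)\|}P_nLP_n+P_nY^{[1]}P_n$$ (with $Y_n=0$ for $n=1$), and let $$\sigma(t)=e^{t(Y_r+D_0)}be^{-t(Y_r+D_0)},\qquad \sigma_n(t)=e^{tX_n}be^{-tX_n},\quad X_n=Y_n+D_n+\tfrac{i}{1-\gamma}P_n.$$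 Write $\|[Y_n]\|$ for the infimum of $\|Y_n+D\|$ over all compact anti-Hermitian diagonal operators $D$. Then: 1. For every $n$: $\sigma_n(0)=b$ and $\sigma_n'(0)=[Y_n,b]\in(T\mathcal O_A)_b$. 2. For every $n$: $P_n$ commutes with $Y_n+D_n$, and $\sigma_n(t)=e^{t(Y_n+D_n)}be^{-t(Y_n+D_n)}$ for all $t\in\mathbb R$. 3. For every $n\ge2$: $\|[Y_n]\|=M_0$, and for $|t_0|\le\pi/(2M_0)$ the restrictions to the interval between $0$ and $t_0$ satisfy $\mathrm L(\sigma_n|_{[0,t_0]})=|t_0|\,\|[Y_n]\|=|t_0|M_0=\mathrm L(\sigma|_{[0,t_0]})$. 4. For every $n\ge2$: $\sigma_n'$ vanishes nowhere, and for $|t_0|\le\pi/(2M_0)$ the curve $\sigma_n|_{[0,t_0]}$ is a minimal length curve in $\mathcal O_A$. 5. $\sigma'(0)=[Y_r,b]$, and $\|\sigma_n'(0)-\sigma'(0)\|_b\to0$ as $n\to\infty$. Moreover $\sigma_n\to\sigma$ uniformly in operator norm on $[-\pi/(2M_0),\pi/(2M_0)]$. -/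

import Mathlib

open Filter Topology MeasureTheory Set
open scoped ENNReal InnerProductSpace

namespace UnitaryOrbit

noncomputable section

section Orbit

variable {H : Type*} [NormedAddCommGroup H] [InnerProductSpace ℂ H] [CompleteSpace H]

/-- The compact anti-Hermitian operators on `H`. -/
def compactSkew (H : Type*) [NormedAddCommGroup H] [InnerProductSpace ℂ H] [CompleteSpace H] :
    Set (H →L[ℂ] H) :=
  {z | IsCompactOperator z ∧ star z = -z}

/-- The unitary Fredholm group: unitaries `u` with `u - 1` compact. -/
def fredholmUnitary (H : Type*) [NormedAddCommGroup H] [InnerProductSpace ℂ H]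
    [CompleteSpace H] : Set (H →L[ℂ] H) :=
  {u | u ∈ unitary (H →L[ℂ] H) ∧ IsCompactOperator (u - 1 : H →L[ℂ] H)}

/-- The orbit `{u A u* : u unitary, u - 1 compact}`. -/
def orbit (A : H →L[ℂ] H) : Set (H →L[ℂ] H) :=
  {x | ∃ u ∈ fredholmUnitary H, x = u * A * star u}

/-- The tangent space `{z b - b z : z compact anti-Hermitian}` of the orbit at `b`. -/
def tangentSpace (b : H →L[ℂ] H) : Set (H →L[ℂ] H) :=
  {x | ∃ z ∈ compactSkew H, z * b - b * z = x}

/-- The Finsler norm `inf {‖z‖ : z compact anti-Hermitian, z b - b z = x}` of `x` at `b`.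
It is `∞` exactly when `x` is not a tangent vector at `b`. -/
def finslerNorm (b x : H →L[ℂ] H) : ℝ≥0∞ :=
  ⨅ z ∈ {z : H →L[ℂ] H | z ∈ compactSkew H ∧ z * b - b * z = x}, ‖z‖ₑ

/-- `β` restricted to the interval `I` is a `C¹` curve with values in the orbit of `A`. -/
def IsSmoothCurve (A : H →L[ℂ] H) (β : ℝ → H →L[ℂ] H) (I : Set ℝ) : Prop :=
  (∀ t ∈ I, β t ∈ orbit A) ∧ ContDiffOn ℝ 1 β I

/-- The length of `β` restricted to `I`: the integral of the Finsler norm of the velocity. -/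
def curveLength (β : ℝ → H →L[ℂ] H) (I : Set ℝ) : ℝ≥0∞ :=
  ∫⁻ t in I, finslerNorm (β t) (derivWithin β I t)

/-- The rectifiable distance in the orbit of `A`: the infimum of the lengths of all smooth curves
in the orbit that join `x` and `y`. -/
def rectDist (A x y : H →L[ℂ] H) : ℝ≥0∞ :=
  ⨅ (s : ℝ) (t : ℝ) (χ : ℝ → H →L[ℂ] H)
    (_ : s < t ∧ IsSmoothCurve A χ (Icc s t) ∧ χ s = x ∧ χ t = y), curveLength χ (Icc s t)

/-- `β`, restricted to the interval with endpoints `0` and `t₀`, is a minimal length curve in the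
orbit of `A`. -/
def IsMinimalLengthCurve (A : H →L[ℂ] H) (β : ℝ → H →L[ℂ] H) (t₀ : ℝ) : Prop :=
  IsSmoothCurve A β (uIcc 0 t₀) ∧ curveLength β (uIcc 0 t₀) = rectDist A (β 0) (β t₀)

/-- The curve `t ↦ e^{tZ} b e^{-tZ}`. -/
def conjCurve (Z b : H →L[ℂ] H) (t : ℝ) : H →L[ℂ] H :=
  NormedSpace.exp ((t : ℂ) • Z) * b * NormedSpace.exp (-((t : ℂ) • Z))

end Orbit

section Matrices

variable {H : Type*} [NormedAddCommGroup H] [InnerProductSpace ℂ H] [CompleteSpace H]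

/-- The distance `inf {‖Y + D‖ : D compact anti-Hermitian and diagonal in the basis e}` from `Y`
to the compact anti-Hermitian diagonal operators. -/
def quotientNorm (e : HilbertBasis ℕ ℂ H) (Y : H →L[ℂ] H) : ℝ :=
  sInf {x | ∃ D ∈ compactSkew H, (∀ i j, i ≠ j → ⟪e i, D (e j)⟫_ℂ = 0) ∧ x = ‖Y + D‖}

open Classical in
/-- The bounded operator whose matrix in the basis `e` has the entry `a j k` in row `j` and
column `k`, where rows and columns are numbered from `1` (so that the `k`-th basis vector is
`e (k - 1)`). -/
def opOfMatrix (e : HilbertBasis ℕ ℂ H) (a : ℕ → ℕ → ℂ) : H →L[ℂ] H :=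
  if h : ∃ T : H →L[ℂ] H, ∀ i j, ⟪e i, T (e j)⟫_ℂ = a (i + 1) (j + 1) then h.choose else 0

/-- The norm of the first column of the matrix of `T`. -/
def firstColNorm (e : HilbertBasis ℕ ℂ H) (T : H →L[ℂ] H) : ℝ := ‖T (e 0)‖

/-- The orthogonal projection `x ↦ ∑ i < n, ⟪e i, x⟫ e i` onto the span of the first `n` basis
vectors. -/
def proj (e : HilbertBasis ℕ ℂ H) (n : ℕ) : H →L[ℂ] H :=
  ∑ i ∈ Finset.range n, InnerProductSpace.rankOne ℂ (e i) (e i)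

/-- Entries (numbered from `1`) of `-i L`: first row and column `0, γ, γ², …`, zero elsewhere. -/
def entryL (γ : ℝ) (j k : ℕ) : ℝ :=
  if j = 1 ∧ k ≠ 1 then γ ^ (k - 1) else if k = 1 ∧ j ≠ 1 then γ ^ (j - 1) else 0

/-- Entries (numbered from `1`) of `-i Y^[1]`: zero in the first row, in the first column and on
the diagonal, and `γ ^ (k - 2)` at the places `(j, k)` and `(k, j)` with `2 ≤ j < k`. -/
def entryY (γ : ℝ) (j k : ℕ) : ℝ :=
  if j = 1 ∨ k = 1 ∨ j = k then 0 else γ ^ (max j k - 2)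

/-- Diagonal entries `d_k` (numbered from `1`) of `-i D₀`. -/
def entryD (γ : ℝ) (k : ℕ) : ℝ :=
  if k = 1 then 0 else -((1 - γ ^ (k - 2)) / (1 - γ)) - γ ^ k / (1 - γ ^ 2)

/-- Diagonal entries `d_k^{(n)}` (numbered from `1`) of `-i D_n`. -/
def entryDn (γ : ℝ) (n k : ℕ) : ℝ :=
  if k = 1 ∨ n < k then 0
  else -(∑ j ∈ Finset.range (k - 2), γ ^ j) - ∑ j ∈ Finset.Ico k n, γ ^ (2 * j - k)

/-- The compact operator `L`. -/
def opL (e : HilbertBasis ℕ ℂ H) (γ : ℝ) : H →L[ℂ] H :=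
  opOfMatrix e fun j k => Complex.I * entryL γ j k

/-- The compact operator `Y^[1]`. -/
def opY1 (e : HilbertBasis ℕ ℂ H) (γ : ℝ) : H →L[ℂ] H :=
  opOfMatrix e fun j k => Complex.I * entryY γ j k

/-- The bounded non-compact diagonal operator `D₀`. -/
def opD0 (e : HilbertBasis ℕ ℂ H) (γ : ℝ) : H →L[ℂ] H :=
  opOfMatrix e fun j k => if j = k then Complex.I * entryD γ k else 0

/-- The finite rank diagonal operator `D_n`. -/
def opDn (e : HilbertBasis ℕ ℂ H) (γ : ℝ) (n : ℕ) : H →L[ℂ] H :=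
  opOfMatrix e fun j k => if j = k then Complex.I * entryDn γ n k else 0

/-- The constant `M₀ = max {sup_n ‖P_n Y^[1] P_n + D_n‖, ‖Y^[1] + D₀‖}`. -/
def M0 (e : HilbertBasis ℕ ℂ H) (γ : ℝ) : ℝ :=
  max (⨆ n : ℕ, ‖proj e n * opY1 e γ * proj e n + opDn e γ n‖) ‖opY1 e γ + opD0 e γ‖

/-- `Y_r = r L + Y^[1]` with `r = M₀ / ‖c₁(L)‖`. -/
def opYr (e : HilbertBasis ℕ ℂ H) (γ : ℝ) : H →L[ℂ] H :=
  ((M0 e γ / firstColNorm e (opL e γ) : ℝ) : ℂ) • opL e γ + opY1 e γ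

/-- `Y_n = r_n P_n L P_n + P_n Y^[1] P_n` with `r_n = M₀ / ‖c₁(P_n L P_n)‖`. -/
def opYn (e : HilbertBasis ℕ ℂ H) (γ : ℝ) (n : ℕ) : H →L[ℂ] H :=
  ((M0 e γ / firstColNorm e (proj e n * opL e γ * proj e n) : ℝ) : ℂ) •
    (proj e n * opL e γ * proj e n) + proj e n * opY1 e γ * proj e n

/-- The limit curve `σ(t) = e^{t Z_r} b e^{-t Z_r}`, where `Z_r = Y_r + D₀`. -/
def sigma (e : HilbertBasis ℕ ℂ H) (γ : ℝ) (b : H →L[ℂ] H) : ℝ → H →L[ℂ] H :=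
  conjCurve (opYr e γ + opD0 e γ) b

/-- The curves `σ_n(t) = e^{t X_n} b e^{-t X_n}`, where `X_n = Y_n + D_n + (i / (1 - γ)) P_n`. -/
def sigmaN (e : HilbertBasis ℕ ℂ H) (γ : ℝ) (b : H →L[ℂ] H) (n : ℕ) : ℝ → H →L[ℂ] H :=
  conjCurve (opYn e γ n + opDn e γ n + (Complex.I / (1 - (γ : ℂ))) • proj e n) b

/-! The infinite matrices above do define bounded operators. -/

set_option linter.unusedSectionVars false in
theorem opOfMatrix_spec (e : HilbertBasis ℕ ℂ H) (a : ℕ → ℕ → ℂ)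
    (h : ∃ T : H →L[ℂ] H, ∀ i j, ⟪e i, T (e j)⟫_ℂ = a (i + 1) (j + 1)) (i j : ℕ) :
    ⟪e i, opOfMatrix e a (e j)⟫_ℂ = a (i + 1) (j + 1) := by
  rw [opOfMatrix, dif_pos h]
  exact h.choose_spec i j

theorem exists_op_of_summable (e : HilbertBasis ℕ ℂ H) (a : ℕ → ℕ → ℂ) (c : ℂ)
    (h : Summable fun p : ℕ × ℕ => ‖a p.1 p.2‖) :
    ∃ T : H →L[ℂ] H, ∀ i j, ⟪e i, T (e j)⟫_ℂ = a i j + if i = j then c else 0 := by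
  have hs : Summable fun p : ℕ × ℕ =>
      a p.1 p.2 • InnerProductSpace.rankOne ℂ (e p.1) (e p.2) := by
    refine Summable.of_norm ?_
    simpa [norm_smul, e.orthonormal.1] using h
  have ho := orthonormal_iff_ite.1 e.orthonormal
  refine ⟨(∑' p : ℕ × ℕ, a p.1 p.2 • InnerProductSpace.rankOne ℂ (e p.1) (e p.2)) +
    c • (1 : H →L[ℂ] H), fun i j => ?_⟩
  have h1 := ((hs.hasSum.mapL (ContinuousLinearMap.apply ℂ H (e j))).mapL
    (innerSL ℂ (e i))).tsum_eq
  simp only [ContinuousLinearMap.apply_apply, innerSL_apply_apply] at h1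
  rw [add_apply, inner_add_right, ← h1, tsum_eq_single (i, j)]
  · simp [ho, inner_smul_right, InnerProductSpace.rankOne_apply, e.orthonormal.1]
  · rintro ⟨k, l⟩ hkl
    simp only [ne_eq, Prod.mk.injEq, not_and_or] at hkl
    simp only [smul_apply, InnerProductSpace.rankOne_apply, inner_smul_right, ho]
    rcases hkl with hkl | hkl
    · simp [Ne.symm hkl]
    · simp [hkl]

theorem exists_op_of_bound (e : HilbertBasis ℕ ℂ H) (a : ℕ → ℕ → ℂ) (c : ℂ) (C ρ : ℝ)
    (h0 : 0 ≤ ρ) (h1 : ρ < 1)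
    (h : ∀ i j, ‖a i j - if i = j then c else 0‖ ≤ C * (ρ ^ i * ρ ^ j)) :
    ∃ T : H →L[ℂ] H, ∀ i j, ⟪e i, T (e j)⟫_ℂ = a i j := by
  have hg := summable_geometric_of_lt_one h0 h1
  have hs : Summable fun p : ℕ × ℕ => ‖a p.1 p.2 - if p.1 = p.2 then c else 0‖ :=
    Summable.of_nonneg_of_le (fun _ => norm_nonneg _) (fun p => h p.1 p.2)
      ((hg.mul_of_nonneg hg (fun _ => pow_nonneg h0 _) (fun _ => pow_nonneg h0 _)).mul_left C)
  obtain ⟨T, hT⟩ := exists_op_of_summable e (fun i j => a i j - if i = j then c else 0) c hs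
  exact ⟨T, fun i j => by rw [hT]; ring⟩

theorem opL_spec (e : HilbertBasis ℕ ℂ H) {γ : ℝ} (hγ1 : |γ| < 1) (i j : ℕ) :
    ⟪e i, opL e γ (e j)⟫_ℂ = Complex.I * entryL γ (i + 1) (j + 1) := by
  refine opOfMatrix_spec e (fun j k => Complex.I * entryL γ j k) ?_ i j
  refine exists_op_of_bound e (fun i j => Complex.I * entryL γ (i + 1) (j + 1)) 0 1 |γ|
    (abs_nonneg _) hγ1 fun i j => ?_
  simp only [ite_self, sub_zero, norm_mul, Complex.norm_I, one_mul, Complex.norm_real,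
    Real.norm_eq_abs, entryL]
  split_ifs with h h' <;> simp_all [abs_pow]
  positivity

theorem opY1_spec (e : HilbertBasis ℕ ℂ H) {γ : ℝ} (hγ0 : γ ≠ 0) (hγ1 : |γ| < 1) (i j : ℕ) :
    ⟪e i, opY1 e γ (e j)⟫_ℂ = Complex.I * entryY γ (i + 1) (j + 1) := by
  refine opOfMatrix_spec e (fun j k => Complex.I * entryY γ j k) ?_ i j
  have hp : 0 < |γ| := abs_pos.2 hγ0
  refine exists_op_of_bound e (fun i j => Complex.I * entryY γ (i + 1) (j + 1)) 0 |γ|⁻¹ √|γ|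
    (Real.sqrt_nonneg _) ((Real.sqrt_lt' one_pos).2 (by simpa using hγ1)) fun i j => ?_
  simp only [ite_self, sub_zero, norm_mul, Complex.norm_I, one_mul, Complex.norm_real,
    Real.norm_eq_abs, entryY]
  split_ifs with h
  · simp only [abs_zero]; positivity
  · have h2 : |γ| ^ (max (i + 1) (j + 1) - 2) = |γ|⁻¹ * √|γ| ^ (2 * max i j) := by
      rw [pow_mul, Real.sq_sqrt hp.le, eq_inv_mul_iff_mul_eq₀ hp.ne', ← pow_succ']
      congr 1
      omega
    rw [abs_pow, h2, ← pow_add]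
    refine mul_le_mul_of_nonneg_left (pow_le_pow_of_le_one (Real.sqrt_nonneg _)
      (Real.sqrt_le_one.2 hγ1.le) (by omega)) (by positivity)

theorem opD0_spec (e : HilbertBasis ℕ ℂ H) {γ : ℝ} (hγ0 : γ ≠ 0) (hγ1 : |γ| < 1) (i j : ℕ) :
    ⟪e i, opD0 e γ (e j)⟫_ℂ = if i = j then Complex.I * entryD γ (j + 1) else 0 := by
  have := opOfMatrix_spec e (fun j k => if j = k then Complex.I * entryD γ k else 0) ?_ i j
  · rw [opD0, this]; simp
  have hp : 0 < |γ| := abs_pos.2 hγ0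
  refine exists_op_of_bound e
    (fun i j => if i + 1 = j + 1 then Complex.I * entryD γ (j + 1) else 0)
    (Complex.I * (-(1 - γ)⁻¹ : ℝ)) (|γ|⁻¹ * |(1 - γ)⁻¹| + |γ / (1 - γ ^ 2)|) √|γ|
    (Real.sqrt_nonneg _) ((Real.sqrt_lt' one_pos).2 (by simpa using hγ1)) fun i j => ?_
  by_cases hij : i = j
  · subst hij
    simp only [if_true, ← mul_sub, norm_mul, Complex.norm_I, one_mul, ← Complex.ofReal_sub,
      Complex.norm_real, Real.norm_eq_abs]
    rw [← mul_pow, Real.mul_self_sqrt hp.le]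
    rcases i with _ | i
    · simp only [entryD, zero_add, if_true, zero_sub, neg_neg, pow_zero, mul_one]
      have : 1 ≤ |γ|⁻¹ := (one_le_inv₀ hp).2 hγ1.le
      nlinarith [abs_nonneg (1 - γ)⁻¹, abs_nonneg (γ / (1 - γ ^ 2))]
    · have h3 : entryD γ (i + 1 + 1) - -(1 - γ)⁻¹ =
          γ ^ i * (1 - γ)⁻¹ - γ ^ (i + 1) * (γ / (1 - γ ^ 2)) := by
        simp only [entryD]
        rw [if_neg (by omega), show i + 1 + 1 - 2 = i by omega]
        ring
      rw [h3]
      refine (abs_sub _ _).trans (le_of_eq ?_)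
      rw [abs_mul, abs_mul, abs_pow, abs_pow, add_mul]
      rw [pow_succ]
      field_simp
  · simp only [add_left_inj, hij, if_false, sub_zero, norm_zero]
    positivity

theorem opDn_spec (e : HilbertBasis ℕ ℂ H) (γ : ℝ) (n i j : ℕ) :
    ⟪e i, opDn e γ n (e j)⟫_ℂ = if i = j then Complex.I * entryDn γ n (j + 1) else 0 := by
  have := opOfMatrix_spec e (fun j k => if j = k then Complex.I * entryDn γ n k else 0) ?_ i j
  · rw [opDn, this]; simp
  have hs : Summable fun p : ℕ × ℕ =>
      ‖if p.1 + 1 = p.2 + 1 then Complex.I * (entryDn γ n (p.2 + 1) : ℂ) else 0‖ := by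
    refine summable_of_ne_finset_zero (s := Finset.range n ×ˢ Finset.range n) ?_
    rintro ⟨i, j⟩ h
    simp only [Finset.mem_product, Finset.mem_range] at h
    by_cases hij : i = j
    · subst hij
      have h0 : entryDn γ n (i + 1) = 0 := if_pos (by omega)
      simp [h0]
    · simp [hij]
  obtain ⟨T, hT⟩ := exists_op_of_summable e
    (fun i j => if i + 1 = j + 1 then Complex.I * (entryDn γ n (j + 1) : ℂ) else 0) 0 hs
  exact ⟨T, fun i j => by simpa using hT i j⟩

end Matrices

end

end UnitaryOrbit

open UnitaryOrbit

set_option linter.unusedSectionVars false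

namespace UnitaryOrbit

section Orbit

variable {H : Type*} [NormedAddCommGroup H] [InnerProductSpace ℂ H] [CompleteSpace H]

/-! ### Curves of the form `t ↦ e^{tZ} b e^{-tZ}` -/

/-! Since `b` is diagonal with distinct eigenvalues, its commutant consists of diagonal operators,
so the Finsler norm of `[Y, b]` at `b` is the distance from `Y` to the compact skew diagonals. It is
bounded below by the first column (`norm_first_column_le`): `Y e₀` is orthogonal to `e₀`, while a
diagonal `D` only adds a multiple of `e₀`.

The truncations reach this bound. The operator `Y_n + D_n` is a `planeSkew`: it acts on the plane of
`e₀` and the first column `f` of `Y_n` as `M₀` times an isometry, plus `W = P_n Y^[1] P_n + D_n`.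
The numbers `d_k^{(n)}` are exactly those for which `W` kills `f` (`sum_entryW_mul_pow`), and `‖W‖ ≤
M₀` by the definition of `M₀`, so `‖Y_n + D_n‖ ≤ M₀` (`norm_planeSkew_le`). Finsler norms are
invariant under unitary conjugation, so these curves have constant speed `M₀`. For the limit curve
`D₀` is not compact; the `D_n` serve as almost optimal diagonals instead (`finslerNorm_eq`).

Minimality compares lengths with angles (`le_curveLength`). Along a curve in the orbit, let `h` be
the spectral projection for one eigenvalue. Then `h' = [z, h]` for any `z` realising the velocity,
and `ψ = 2⟪v, h v⟫ - 1` satisfies `|ψ'| ≤ 2‖z‖√(1 - ψ²)`, so `arccos ψ / 2` changes no faster than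
arc length. To avoid differentiating spectral projections, they are replaced by polynomials `peak`
with values in `[0, 1]` on the spectrum, and a factor `c < 1` keeps `arccos` off its singular
points; both approximations are removed in the limit. On the plane block `⟪e₀, exp(tZ) e₀⟫ = cos(t
M₀)`, so the angle equals `|t| M₀` up to `|t| M₀ = π/2`.

For convergence, `Y_n → Y_r` in norm because the matrix entries are absolutely summable. The entries
of `D₀` tend to `-1/(1 - γ)`, so `D_n` needs the correction `i/(1 - γ) P_n` to converge in norm, to
`D₀ + i/(1 - γ)`. Neither correction affects the curves: each commutes with `b` and with the
remaining part of the generator. -/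

theorem hasDerivAt_conjCurve (Z b : H →L[ℂ] H) (t : ℝ) :
    HasDerivAt (conjCurve Z b)
      (NormedSpace.exp ((t : ℂ) • Z) * (Z * b - b * Z) * NormedSpace.exp (-((t : ℂ) • Z))) t := by
  have h1 : HasDerivAt (fun w : ℂ => NormedSpace.exp (w • Z)) (NormedSpace.exp ((t : ℂ) • Z) * Z)
      (t : ℂ) := hasDerivAt_exp_smul_const Z _
  have h2 : HasDerivAt (fun w : ℂ => NormedSpace.exp (-(w • Z)))
      (-(Z * NormedSpace.exp (-((t : ℂ) • Z)))) (t : ℂ) := by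
    simpa using hasDerivAt_exp_smul_const' (-Z) (t : ℂ)
  have h3 := ((h1.mul_const b).mul h2).scomp_of_eq t Complex.ofRealCLM.hasDerivAt rfl
  simp only [Complex.ofRealCLM_apply, Complex.ofReal_one, one_smul] at h3
  refine HasDerivAt.congr_deriv (f := conjCurve Z b) h3 ?_
  noncomm_ring

theorem continuous_conjCurve_uncurry (b : H →L[ℂ] H) :
    Continuous (fun p : (H →L[ℂ] H) × ℝ => conjCurve p.1 b p.2) := by
  let _ : NormedAlgebra ℚ (H →L[ℂ] H) := .restrictScalars ℚ ℂ _
  unfold conjCurve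
  have : Continuous (NormedSpace.exp : (H →L[ℂ] H) → (H →L[ℂ] H)) :=
    NormedSpace.exp_continuous
  fun_prop

theorem contDiff_conjCurve (Z b : H →L[ℂ] H) : ContDiff ℝ 1 (conjCurve Z b) := by
  rw [contDiff_one_iff_deriv]
  refine ⟨fun t => (hasDerivAt_conjCurve Z b t).differentiableAt, ?_⟩
  rw [show deriv (conjCurve Z b) = conjCurve Z (Z * b - b * Z) from
    funext fun t => (hasDerivAt_conjCurve Z b t).deriv]
  exact (continuous_conjCurve_uncurry _).comp (by fun_prop : Continuous fun t : ℝ => (Z, t))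

theorem conjCurve_zero (Z b : H →L[ℂ] H) : conjCurve Z b 0 = b := by
  simp [conjCurve]

/-- The factors `exp(tC)` and `exp(-tC)` move past `b` and cancel. This removes both the `P_n` term
of `X_n` and the scalar added to the limit generator. -/
theorem conjCurve_add_of_commute {Z C b : H →L[ℂ] H} (hZ : Commute Z C) (hb : Commute C b) :
    conjCurve (Z + C) b = conjCurve Z b := by
  let _ : NormedAlgebra ℚ (H →L[ℂ] H) := .restrictScalars ℚ ℂ _
  funext t
  have h1 : Commute ((t : ℂ) • Z) ((t : ℂ) • C) := (hZ.smul_left _).smul_right _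
  have h2 : Commute (NormedSpace.exp ((t : ℂ) • C)) b := (hb.smul_left _).exp_left
  have h3 : NormedSpace.exp ((t : ℂ) • C) * NormedSpace.exp (-((t : ℂ) • C)) = 1 := by
    rw [← NormedSpace.exp_add_of_commute (Commute.refl _).neg_right, add_neg_cancel,
      NormedSpace.exp_zero]
  simp only [conjCurve, smul_add, neg_add_rev]
  rw [NormedSpace.exp_add_of_commute h1,
    NormedSpace.exp_add_of_commute h1.symm.neg_left.neg_right, mul_assoc (NormedSpace.exp _) _ b,
    h2.eq, ← mul_assoc, ← mul_assoc, mul_assoc _ (NormedSpace.exp ((t : ℂ) • C)), h3, mul_one]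

theorem exp_smul_mem_unitary {Z : H →L[ℂ] H} (hZ : star Z = -Z) (t : ℝ) :
    NormedSpace.exp ((t : ℂ) • Z) ∈ unitary (H →L[ℂ] H) := by
  let _ : NormedAlgebra ℚ (H →L[ℂ] H) := .restrictScalars ℚ ℂ _
  refine NormedSpace.exp_mem_unitary_of_mem_skewAdjoint ?_
  rw [skewAdjoint.mem_iff, star_smul, hZ]
  simp

theorem star_exp_smul {Z : H →L[ℂ] H} (hZ : star Z = -Z) (t : ℝ) :
    star (NormedSpace.exp ((t : ℂ) • Z)) = NormedSpace.exp (-((t : ℂ) • Z)) := by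
  rw [NormedSpace.star_exp, star_smul, hZ]
  simp

theorem conjCurve_eq {Z : H →L[ℂ] H} (hZ : star Z = -Z) (b : H →L[ℂ] H) (t : ℝ) :
    conjCurve Z b t =
      NormedSpace.exp ((t : ℂ) • Z) * b * star (NormedSpace.exp ((t : ℂ) • Z)) := by
  rw [star_exp_smul hZ, conjCurve]

/-! ### Compact operators -/

theorem isCompactOperator_mul_left {T : H →L[ℂ] H} (hT : IsCompactOperator T) (S : H →L[ℂ] H) :
    IsCompactOperator (S * T : H →L[ℂ] H) := hT.clm_comp S

theorem isCompactOperator_mul_right {T : H →L[ℂ] H} (hT : IsCompactOperator T) (S : H →L[ℂ] H) :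
    IsCompactOperator (T * S : H →L[ℂ] H) := hT.comp_clm S

/-- Without its constant term, every partial sum of the exponential series is compact, and
compactness passes to norm limits. -/
theorem isCompactOperator_exp_sub_one {Z : H →L[ℂ] H} (hZ : IsCompactOperator Z) :
    IsCompactOperator (NormedSpace.exp Z - 1 : H →L[ℂ] H) := by
  have h1 := (hasSum_nat_add_iff' 1).2 (NormedSpace.exp_series_hasSum_exp' (𝕂 := ℂ) Z)
  simp only [Finset.range_one, Finset.sum_singleton, Nat.factorial_zero, Nat.cast_one, inv_one,
    pow_zero, one_smul] at h1
  refine isCompactOperator_of_tendsto h1 (Eventually.of_forall fun s => ?_)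
  refine (compactOperator (RingHom.id ℂ) H H).sum_mem fun k _ => ?_
  rw [pow_succ]
  exact (isCompactOperator_mul_left hZ _).smul _

theorem mul_mem_fredholmUnitary {u v : H →L[ℂ] H} (hu : u ∈ fredholmUnitary H)
    (hv : v ∈ fredholmUnitary H) : u * v ∈ fredholmUnitary H := by
  refine ⟨mul_mem hu.1 hv.1, ?_⟩
  have : u * v - 1 = (u - 1) * v + (v - 1) := by noncomm_ring
  rw [this]
  exact (isCompactOperator_mul_right hu.2 v).add hv.2

theorem star_mem_fredholmUnitary {u : H →L[ℂ] H} (hu : u ∈ fredholmUnitary H) :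
    star u ∈ fredholmUnitary H := by
  refine ⟨Unitary.star_mem hu.1, ?_⟩
  have : star u - 1 = -(star u * (u - 1)) := by
    rw [mul_sub, Unitary.star_mul_self_of_mem hu.1]; noncomm_ring
  rw [this]
  exact (isCompactOperator_mul_left hu.2 _).neg

theorem conjCurve_mem_orbit {A b u Z : H →L[ℂ] H} (hu : u ∈ fredholmUnitary H)
    (hA : A = u * b * star u) (hZ : Z ∈ compactSkew H) (t : ℝ) :
    conjCurve Z b t ∈ orbit A := by
  have hE : NormedSpace.exp ((t : ℂ) • Z) ∈ fredholmUnitary H :=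
    ⟨exp_smul_mem_unitary hZ.2 t, isCompactOperator_exp_sub_one (hZ.1.smul _)⟩
  refine ⟨_, mul_mem_fredholmUnitary hE (star_mem_fredholmUnitary hu), ?_⟩
  have h := Unitary.star_mul_self_of_mem hu.1
  have hb : star u * A * u = b := by
    rw [hA, ← mul_assoc, ← mul_assoc, h, one_mul, mul_assoc, h, mul_one]
  rw [conjCurve_eq hZ.2, star_mul, star_star, ← hb]
  simp only [mul_assoc]

theorem isSmoothCurve_conjCurve {A b u Z : H →L[ℂ] H} (hu : u ∈ fredholmUnitary H)
    (hA : A = u * b * star u) (hZ : Z ∈ compactSkew H) (I : Set ℝ) :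
    IsSmoothCurve A (conjCurve Z b) I :=
  ⟨fun t _ => conjCurve_mem_orbit hu hA hZ t, (contDiff_conjCurve Z b).contDiffOn⟩

/-! ### The Finsler norm -/

theorem sub_mem_compactSkew {y z : H →L[ℂ] H} (hy : y ∈ compactSkew H) (hz : z ∈ compactSkew H) :
    y - z ∈ compactSkew H :=
  ⟨hy.1.sub hz.1, by rw [star_sub, hy.2, hz.2]; abel⟩

theorem add_mem_compactSkew {y z : H →L[ℂ] H} (hy : y ∈ compactSkew H) (hz : z ∈ compactSkew H) :
    y + z ∈ compactSkew H :=
  ⟨hy.1.add hz.1, by rw [star_add, hy.2, hz.2]; abel⟩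

theorem real_smul_mem_compactSkew {z : H →L[ℂ] H} (r : ℝ) (hz : z ∈ compactSkew H) :
    (r : ℂ) • z ∈ compactSkew H :=
  ⟨hz.1.smul _, by rw [star_smul, hz.2]; simp⟩

theorem finslerNorm_le {b x z : H →L[ℂ] H} (hz : z ∈ compactSkew H) (h : z * b - b * z = x) :
    finslerNorm b x ≤ ‖z‖ₑ := iInf₂_le z ⟨hz, h⟩

/-- Conjugation by `U` carries lifts `z` of `x` to lifts of the conjugated vector, with the same
norm. Only unitarity of `U` is needed, not compactness of `U - 1`; hence the result also covers the
limit curve, whose generator contains the non-compact `D₀`. -/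
theorem finslerNorm_conj_le {U : H →L[ℂ] H} (hU : U ∈ unitary (H →L[ℂ] H)) (b x : H →L[ℂ] H) :
    finslerNorm (U * b * star U) (U * x * star U) ≤ finslerNorm b x := by
  refine le_iInf₂ fun z hz => ?_
  have h := Unitary.star_mul_self_of_mem hU
  have h' (y w : H →L[ℂ] H) : U * y * star U * (U * w * star U) = U * (y * w) * star U := by
    rw [mul_assoc (U * y), ← mul_assoc (star U), ← mul_assoc (star U), h, one_mul]
    simp only [mul_assoc]
  have hn : ‖U * z * star U‖ₑ = ‖z‖ₑ := by
    rw [← ofReal_norm, ← ofReal_norm, CStarRing.norm_mul_mem_unitary _ (Unitary.star_mem hU),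
      CStarRing.norm_mem_unitary_mul _ hU]
  rw [← hn]
  refine finslerNorm_le ⟨isCompactOperator_mul_right (isCompactOperator_mul_left hz.1.1 U) _, ?_⟩ ?_
  · rw [star_mul, star_mul, star_star, hz.1.2]; noncomm_ring
  · rw [h', h', ← hz.2]; noncomm_ring

theorem finslerNorm_conj {U : H →L[ℂ] H} (hU : U ∈ unitary (H →L[ℂ] H)) (b x : H →L[ℂ] H) :
    finslerNorm (U * b * star U) (U * x * star U) = finslerNorm b x := by
  refine le_antisymm (finslerNorm_conj_le hU b x) ?_
  have h := finslerNorm_conj_le (Unitary.star_mem hU) (U * b * star U) (U * x * star U)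
  have h' (y : H →L[ℂ] H) : star U * (U * y * star U) * star (star U) = y := by
    have := Unitary.star_mul_self_of_mem hU
    rw [star_star, ← mul_assoc, ← mul_assoc, this, one_mul, mul_assoc, this, mul_one]
  rwa [h', h'] at h

theorem finslerNorm_deriv_conjCurve {Z : H →L[ℂ] H} (hZ : star Z = -Z) (b : H →L[ℂ] H) (t : ℝ) :
    finslerNorm (conjCurve Z b t) (deriv (conjCurve Z b) t) = finslerNorm b (Z * b - b * Z) := by
  rw [(hasDerivAt_conjCurve Z b t).deriv, conjCurve_eq hZ, ← star_exp_smul hZ,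
    finslerNorm_conj (exp_smul_mem_unitary hZ t)]

theorem curveLength_conjCurve {Z : H →L[ℂ] H} (hZ : star Z = -Z) (b : H →L[ℂ] H) (s t : ℝ) :
    curveLength (conjCurve Z b) (Icc s t) =
      finslerNorm b (Z * b - b * Z) * ENNReal.ofReal (t - s) := by
  rcases lt_or_ge s t with hst | hst
  · rw [curveLength, setLIntegral_congr_fun (g := fun _ => finslerNorm b (Z * b - b * Z))
      measurableSet_Icc, setLIntegral_const, Real.volume_Icc]
    intro x hx
    simp only
    rw [((hasDerivAt_conjCurve Z b x).differentiableAt).derivWithin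
      (uniqueDiffOn_Icc hst x hx), finslerNorm_deriv_conjCurve hZ]
  · have h0 : volume (Icc s t) = 0 := by simp [hst]
    rw [curveLength, setLIntegral_measure_zero _ _ h0, ENNReal.ofReal_of_nonpos (by linarith),
      mul_zero]

theorem curveLength_conjCurve_uIcc {Z : H →L[ℂ] H} (hZ : star Z = -Z) (b : H →L[ℂ] H) (t : ℝ) :
    curveLength (conjCurve Z b) (uIcc 0 t) =
      finslerNorm b (Z * b - b * Z) * ENNReal.ofReal |t| := by
  rw [uIcc, curveLength_conjCurve hZ, max_sub_min_eq_abs, sub_zero]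

theorem conjCurve_smul (Z b : H →L[ℂ] H) (r t : ℝ) :
    conjCurve ((r : ℂ) • Z) b t = conjCurve Z b (t * r) := by
  simp only [conjCurve, smul_smul, Complex.ofReal_mul]

/-- The curve `e^{tZ} b e^{-tZ}` bounds the distance of its endpoints by `|t| ‖Z‖`. -/
theorem rectDist_conjCurve_le {A b u Z : H →L[ℂ] H} (hu : u ∈ fredholmUnitary H)
    (hA : A = u * b * star u) (hZ : Z ∈ compactSkew H) (t : ℝ) :
    rectDist A b (conjCurve Z b t) ≤ ENNReal.ofReal (|t| * ‖Z‖) := by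
  -- Competitors for `rectDist` live on `[s, t]` with `s < t`; rescaling the generator by `t` and
  -- running over `[0, 1]` treats all signs of `t`, and `t = 0`, at once.
  have hZ' := real_smul_mem_compactSkew t hZ
  have h : rectDist A b (conjCurve Z b t) ≤ curveLength (conjCurve ((t : ℂ) • Z) b) (Icc 0 1) :=
    iInf_le_of_le (0 : ℝ) <| iInf_le_of_le (1 : ℝ) <|
      iInf_le_of_le (conjCurve ((t : ℂ) • Z) b) <| iInf_le_of_le ⟨one_pos,
        isSmoothCurve_conjCurve hu hA hZ' _, conjCurve_zero _ _, by
          rw [conjCurve_smul, one_mul]⟩ le_rfl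
  refine h.trans ?_
  rw [curveLength_conjCurve hZ'.2, sub_zero, ENNReal.ofReal_one, mul_one]
  refine (finslerNorm_le hZ' rfl).trans_eq ?_
  rw [← ofReal_norm, norm_smul, Complex.norm_real, Real.norm_eq_abs]

end Orbit

section Diagonal

variable {H : Type*} [NormedAddCommGroup H] [InnerProductSpace ℂ H] [CompleteSpace H]

/-! ### Operators and their matrices -/

theorem ext_inner_basis (e : HilbertBasis ℕ ℂ H) {x y : H} (h : ∀ i, ⟪e i, x⟫_ℂ = ⟪e i, y⟫_ℂ) :
    x = y := by
  refine e.repr.injective (lp.ext (funext fun i => ?_))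
  rw [e.repr_apply_apply, e.repr_apply_apply, h]

theorem ext_basis (e : HilbertBasis ℕ ℂ H) {S T : H →L[ℂ] H} (h : ∀ j, S (e j) = T (e j)) :
    S = T := by
  refine ContinuousLinearMap.ext fun x => ?_
  have h1 := (e.hasSum_repr x).mapL S
  have h2 := (e.hasSum_repr x).mapL T
  simp only [map_smul, h] at h1 h2
  exact h1.unique h2

theorem ext_entries (e : HilbertBasis ℕ ℂ H) {S T : H →L[ℂ] H}
    (h : ∀ i j, ⟪e i, S (e j)⟫_ℂ = ⟪e i, T (e j)⟫_ℂ) : S = T :=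
  ext_basis e fun j => ext_inner_basis e fun i => h i j

theorem star_eq_neg_of_entries (e : HilbertBasis ℕ ℂ H) {T : H →L[ℂ] H}
    (h : ∀ i j, star ⟪e j, T (e i)⟫_ℂ = -⟪e i, T (e j)⟫_ℂ) : star T = -T := by
  refine ext_entries e fun i j => ?_
  rw [ContinuousLinearMap.star_eq_adjoint, ContinuousLinearMap.adjoint_inner_right, neg_apply,
    inner_neg_right, ← h, ← inner_conj_symm]
  rfl

theorem hasSum_norm_sq (e : HilbertBasis ℕ ℂ H) (x : H) :
    HasSum (fun i => ‖⟪e i, x⟫_ℂ‖ ^ 2) (‖x‖ ^ 2) := by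
  have h := Complex.hasSum_re (e.hasSum_inner_mul_inner x x)
  rw [inner_self_eq_norm_sq_to_K] at h
  convert h using 1
  · funext i
    rw [← inner_conj_symm x, Complex.conj_mul']
    norm_cast
  · norm_cast

theorem apply_eq_smul_of_entries (e : HilbertBasis ℕ ℂ H) {T : H →L[ℂ] H} {d : ℕ → ℂ}
    (h : ∀ i j, ⟪e i, T (e j)⟫_ℂ = if i = j then d j else 0) (j : ℕ) : T (e j) = d j • e j := by
  refine ext_inner_basis e fun i => ?_
  rw [h, inner_smul_right, orthonormal_iff_ite.1 e.orthonormal]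
  simp

theorem inner_diag (e : HilbertBasis ℕ ℂ H) {T : H →L[ℂ] H} {d : ℕ → ℂ}
    (h : ∀ j, T (e j) = d j • e j) (i : ℕ) (x : H) : ⟪e i, T x⟫_ℂ = d i * ⟪e i, x⟫_ℂ := by
  have h1 := ((e.hasSum_repr x).mapL T).mapL (innerSL ℂ (e i))
  refine h1.unique ?_
  convert hasSum_single i fun j hj => ?_ using 1
  · simp [h, e.repr_apply_apply, e.orthonormal.1, mul_comm]
  · simp [h, orthonormal_iff_ite.1 e.orthonormal, Ne.symm hj]

theorem hasSum_norm_sq_diag (e : HilbertBasis ℕ ℂ H) {T : H →L[ℂ] H} {d : ℕ → ℂ}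
    (h : ∀ j, T (e j) = d j • e j) (x : H) :
    HasSum (fun i => ‖d i‖ ^ 2 * ‖⟪e i, x⟫_ℂ‖ ^ 2) (‖T x‖ ^ 2) := by
  simpa [inner_diag e h, mul_pow] using hasSum_norm_sq e (T x)

theorem hasSum_re_inner_diag (e : HilbertBasis ℕ ℂ H) {T : H →L[ℂ] H} {d : ℕ → ℝ}
    (h : ∀ j, T (e j) = (d j : ℂ) • e j) (x : H) :
    HasSum (fun i => d i * ‖⟪e i, x⟫_ℂ‖ ^ 2) (⟪x, T x⟫_ℂ).re := by
  have h1 := Complex.hasSum_re (e.hasSum_inner_mul_inner x (T x))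
  convert h1 using 1
  funext i
  rw [inner_diag e h, ← inner_conj_symm x, mul_left_comm, Complex.conj_mul']
  norm_cast

theorem norm_diag_le (e : HilbertBasis ℕ ℂ H) {T : H →L[ℂ] H} {d : ℕ → ℂ}
    (h : ∀ j, T (e j) = d j • e j) {C : ℝ} (hC : 0 ≤ C) (hd : ∀ i, ‖d i‖ ≤ C) : ‖T‖ ≤ C := by
  refine T.opNorm_le_bound hC fun x => ?_
  refine (sq_le_sq₀ (norm_nonneg _) (by positivity)).1 ?_
  rw [mul_pow]
  refine hasSum_le (fun i => ?_) (hasSum_norm_sq_diag e h x) ((hasSum_norm_sq e x).mul_left _)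
  gcongr
  exact hd i

theorem star_diag_real (e : HilbertBasis ℕ ℂ H) {T : H →L[ℂ] H} {d : ℕ → ℝ}
    (h : ∀ j, T (e j) = (d j : ℂ) • e j) : star T = T := by
  refine ext_entries e fun i j => ?_
  rw [ContinuousLinearMap.star_eq_adjoint, ContinuousLinearMap.adjoint_inner_right, h, h,
    inner_smul_left, inner_smul_right, orthonormal_iff_ite.1 e.orthonormal]
  by_cases hij : i = j <;> simp [hij]

/-- An operator commuting with a diagonal operator with distinct entries is diagonal. -/
theorem inner_eq_zero_of_commute (e : HilbertBasis ℕ ℂ H) {b z : H →L[ℂ] H} {lam : ℕ → ℝ}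
    (hlam : Function.Injective lam) (hb : ∀ i, b (e i) = (lam i : ℂ) • e i) (hz : z * b = b * z)
    {i j : ℕ} (hij : i ≠ j) : ⟪e i, z (e j)⟫_ℂ = 0 := by
  have h1 : ⟪e i, z (b (e j))⟫_ℂ = ⟪e i, b (z (e j))⟫_ℂ := congrArg (fun T => ⟪e i, T (e j)⟫_ℂ) hz
  rw [hb, map_smul, inner_smul_right, inner_diag e hb] at h1
  have h2 : ((lam j : ℂ) - lam i) * ⟪e i, z (e j)⟫_ℂ = 0 := by rw [sub_mul, h1, sub_self]
  exact (mul_eq_zero.1 h2).resolve_left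
    (sub_ne_zero.2 fun h => hij (hlam (Complex.ofReal_injective h)).symm)

theorem commute_of_diag (e : HilbertBasis ℕ ℂ H) {S T : H →L[ℂ] H} {c d : ℕ → ℂ}
    (hS : ∀ j, S (e j) = c j • e j) (hT : ∀ j, T (e j) = d j • e j) : Commute S T :=
  ext_basis e fun j => by
    simp only [mul_apply_eq_comp, hS, hT, map_smul, smul_smul, mul_comm]

end Diagonal

section Minimality

variable {H : Type*} [NormedAddCommGroup H] [InnerProductSpace ℂ H] [CompleteSpace H]

/-! ### A lower bound for the length of curves in the orbit -/

/-- The polynomial `(1 - (x - l)² / R²) ^ m`. It peaks at `l`, where its value is `1`. -/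
noncomputable def peak (l R : ℝ) (m : ℕ) (x : H →L[ℂ] H) : H →L[ℂ] H :=
  (1 - ((R ^ 2)⁻¹ : ℝ) • ((x - (l : ℂ) • 1) * (x - (l : ℂ) • 1))) ^ m

theorem peak_conj (l R : ℝ) (m : ℕ) {V : H →L[ℂ] H} (hV : V ∈ unitary (H →L[ℂ] H))
    (x : H →L[ℂ] H) : peak l R m (V * x * star V) = V * peak l R m x * star V := by
  have h := Unitary.star_mul_self_of_mem hV
  have h1 := Unitary.mul_star_self_of_mem hV
  have h' (y w : H →L[ℂ] H) : V * y * star V * (V * w * star V) = V * (y * w) * star V := by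
    rw [mul_assoc (V * y), ← mul_assoc (star V), ← mul_assoc (star V), h, one_mul]
    simp only [mul_assoc]
  have hp (y : H →L[ℂ] H) : (V * y * star V) ^ m = V * y ^ m * star V := by
    induction m with
    | zero => simp [h1]
    | succ k ih => rw [pow_succ, ih, h', pow_succ]
  have h2 : V * x * star V - (l : ℂ) • 1 = V * (x - (l : ℂ) • 1) * star V := by
    rw [mul_sub, sub_mul, mul_smul_comm, mul_one, smul_mul_assoc, h1]
  rw [peak, peak, ← hp, h2, h']
  congr 1
  generalize (x - (l : ℂ) • 1) * (x - (l : ℂ) • 1) = y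
  rw [mul_sub, sub_mul, mul_one, h1, mul_smul_comm, smul_mul_assoc]

theorem peak_diag (e : HilbertBasis ℕ ℂ H) {b : H →L[ℂ] H} {lam : ℕ → ℝ}
    (hb : ∀ i, b (e i) = (lam i : ℂ) • e i) (l R : ℝ) (m j : ℕ) :
    peak l R m b (e j) = (((1 - (lam j - l) ^ 2 / R ^ 2) ^ m : ℝ) : ℂ) • e j := by
  induction m with
  | zero => simp [peak]
  | succ k ih =>
    rw [peak, pow_succ', mul_apply_eq_comp]
    rw [peak] at ih
    rw [ih, map_smul, pow_succ (1 - (lam j - l) ^ 2 / R ^ 2), Complex.ofReal_mul, mul_smul]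
    congr 1
    simp only [sub_apply, one_apply_eq_self, smul_apply, mul_apply_eq_comp,
      hb, map_smul, map_sub]
    rw [← Complex.coe_smul]
    push_cast
    module

/-- The commutator with `z` is a derivation, so solutions of `f' = [z, f]` are closed under
products. Hence polynomials in a solution, such as `peak`, solve the same equation. -/
theorem hasDerivWithinAt_commutator_mul {f g : ℝ → H →L[ℂ] H} {z : H →L[ℂ] H} {I : Set ℝ} {t : ℝ}
    (hf : HasDerivWithinAt f (z * f t - f t * z) I t)
    (hg : HasDerivWithinAt g (z * g t - g t * z) I t) :
    HasDerivWithinAt (fun s => f s * g s) (z * (f t * g t) - f t * g t * z) I t := by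
  refine HasDerivWithinAt.congr_deriv (hf.mul hg) ?_
  noncomm_ring

theorem hasDerivWithinAt_peak (l R : ℝ) (m : ℕ) {χ : ℝ → H →L[ℂ] H} {z : H →L[ℂ] H} {I : Set ℝ}
    {t : ℝ} (h : HasDerivWithinAt χ (z * χ t - χ t * z) I t) :
    HasDerivWithinAt (fun s => peak l R m (χ s))
      (z * peak l R m (χ t) - peak l R m (χ t) * z) I t := by
  have h1 : HasDerivWithinAt (fun s => χ s - (l : ℂ) • (1 : H →L[ℂ] H))
      (z * (χ t - (l : ℂ) • 1) - (χ t - (l : ℂ) • 1) * z) I t := by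
    refine HasDerivWithinAt.congr_deriv (h.sub_const _) ?_
    simp only [mul_sub, sub_mul, mul_smul_comm, smul_mul_assoc, mul_one, one_mul]
    abel
  have h2 : HasDerivWithinAt (fun s => peak l R 1 (χ s))
      (z * peak l R 1 (χ t) - peak l R 1 (χ t) * z) I t := by
    simp only [peak, pow_one]
    refine HasDerivWithinAt.congr_deriv
      (((hasDerivWithinAt_commutator_mul h1 h1).const_smul ((R ^ 2)⁻¹ : ℝ)).const_sub 1) ?_
    simp only [mul_sub z 1, sub_mul 1 _ z, mul_smul_comm, smul_mul_assoc, mul_one, one_mul,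
      smul_sub]
    abel
  induction m with
  | zero => simpa [peak] using hasDerivWithinAt_const t I (1 : H →L[ℂ] H)
  | succ k ih =>
    simpa only [peak, pow_succ (1 - _ : H →L[ℂ] H), pow_zero, one_mul] using
      hasDerivWithinAt_commutator_mul ih h2

theorem contDiffOn_peak (l R : ℝ) (m : ℕ) {χ : ℝ → H →L[ℂ] H} {I : Set ℝ}
    (h : ContDiffOn ℝ 1 χ I) : ContDiffOn ℝ 1 (fun s => peak l R m (χ s)) I := by
  unfold peak
  have h1 := h.sub (contDiffOn_const (c := (l : ℂ) • (1 : H →L[ℂ] H)))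
  exact ((contDiffOn_const (c := (1 : H →L[ℂ] H))).sub ((h1.mul h1).const_smul _)).pow m

/-- All eigenvalues of `peak l R m b` lie in `[0, 1]`, where squares are at most the numbers
themselves. This replaces idempotence of a projection. -/
theorem norm_peak_sq_le (e : HilbertBasis ℕ ℂ H) {b : H →L[ℂ] H} {lam : ℕ → ℝ}
    (hb : ∀ i, b (e i) = (lam i : ℂ) • e i) {l R : ℝ} (hR : ∀ i, (lam i - l) ^ 2 ≤ R ^ 2) (m : ℕ)
    (x : H) : ‖peak l R m b x‖ ^ 2 ≤ (⟪x, peak l R m b x⟫_ℂ).re := by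
  refine hasSum_le (fun i => ?_) (hasSum_norm_sq_diag e (peak_diag e hb l R m) x)
    (hasSum_re_inner_diag e (peak_diag e hb l R m) x)
  have h1 : (lam i - l) ^ 2 / R ^ 2 ≤ 1 := div_le_one_of_le₀ (hR i) (sq_nonneg _)
  have h2 : 0 ≤ (lam i - l) ^ 2 / R ^ 2 := by positivity
  have h3 : 0 ≤ (1 - (lam i - l) ^ 2 / R ^ 2) ^ m := pow_nonneg (by linarith) _
  have h4 : (1 - (lam i - l) ^ 2 / R ^ 2) ^ m ≤ 1 := pow_le_one₀ (by linarith) (by linarith)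
  rw [Complex.norm_real, Real.norm_eq_abs, sq_abs]
  exact mul_le_mul_of_nonneg_right (by nlinarith) (sq_nonneg _)

theorem peak_of_conj (e : HilbertBasis ℕ ℂ H) {b V : H →L[ℂ] H} {lam : ℕ → ℝ}
    (hb : ∀ i, b (e i) = (lam i : ℂ) • e i) {l R : ℝ} (hR : ∀ i, (lam i - l) ^ 2 ≤ R ^ 2) (m : ℕ)
    (hV : V ∈ unitary (H →L[ℂ] H)) :
    star (peak l R m (V * b * star V)) = peak l R m (V * b * star V) ∧
      ∀ v, ‖peak l R m (V * b * star V) v‖ ^ 2 ≤ (⟪v, peak l R m (V * b * star V) v⟫_ℂ).re := by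
  rw [peak_conj l R m hV]
  refine ⟨?_, fun v => ?_⟩
  · rw [star_mul, star_mul, star_star, star_diag_real e (peak_diag e hb l R m), mul_assoc]
  · have h := norm_peak_sq_le e hb hR m (star V v)
    rw [ContinuousLinearMap.star_eq_adjoint, ContinuousLinearMap.adjoint_inner_left] at h
    rw [mul_apply_eq_comp, mul_apply_eq_comp,
      ContinuousLinearMap.star_eq_adjoint,
      ContinuousLinearMap.norm_map_of_mem_unitary hV]
    exact h

/-- The derivative of `τ ↦ ⟪v, h(τ) v⟫` along `h' = z h - h z`, where `0 ≤ h ≤ 1`. -/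
theorem abs_re_inner_commutator_le {h z : H →L[ℂ] H} (hh : star h = h) (hz : star z = -z) {v : H}
    (hv : ‖v‖ = 1) (hhv : ‖h v‖ ^ 2 ≤ (⟪v, h v⟫_ℂ).re) :
    |2 * (⟪v, (z * h - h * z) v⟫_ℂ).re| ≤
      2 * ‖z‖ * √(1 - (2 * (⟪v, h v⟫_ℂ).re - 1) ^ 2) := by
  set m := (⟪v, h v⟫_ℂ).re with hm
  rw [ContinuousLinearMap.star_eq_adjoint] at hh hz
  have h1 : ⟪v, (z * h - h * z) v⟫_ℂ = -⟪z v, h v⟫_ℂ - ⟪h v, z v⟫_ℂ := by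
    rw [sub_apply, inner_sub_right, mul_apply_eq_comp, mul_apply_eq_comp,
      ← ContinuousLinearMap.adjoint_inner_left h, hh, ← ContinuousLinearMap.adjoint_inner_left z,
      hz, neg_apply, inner_neg_left]
  -- `z` is skew, so `⟪z v, v⟫` is imaginary, and `h v` may be replaced by `h v - m v` at no cost.
  have h0 : (⟪z v, v⟫_ℂ).re = 0 := by
    have h2 : ⟪z v, v⟫_ℂ = -⟪v, z v⟫_ℂ := by
      rw [← ContinuousLinearMap.adjoint_inner_right, hz]; simp
    have h3 := congrArg Complex.re h2
    rw [← inner_conj_symm v, Complex.neg_re, Complex.conj_re] at h3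
    linarith
  have h2 : (⟪v, (z * h - h * z) v⟫_ℂ).re = -2 * (⟪z v, h v - (m : ℂ) • v⟫_ℂ).re := by
    rw [h1, inner_sub_right, inner_smul_right, Complex.sub_re, Complex.sub_re,
      Complex.re_ofReal_mul, h0, ← inner_conj_symm (h v), Complex.conj_re, Complex.neg_re]
    ring
  have h3 : ‖h v - (m : ℂ) • v‖ ^ 2 = ‖h v‖ ^ 2 - m ^ 2 := by
    rw [@norm_sub_sq ℂ, inner_smul_right, norm_smul, hv, ← inner_conj_symm]
    simp only [RCLike.re_to_complex, Complex.re_ofReal_mul, Complex.conj_re, ← hm,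
      Complex.norm_real, Real.norm_eq_abs, mul_one, sq_abs]
    ring
  -- A variance bound: `‖h v - m v‖² = ‖h v‖² - m² ≤ m - m²`, and `4(m - m²) = 1 - (2m - 1)²`.
  have h4 : 2 * ‖h v - (m : ℂ) • v‖ ≤ √(1 - (2 * m - 1) ^ 2) := by
    refine Real.le_sqrt_of_sq_le ?_
    rw [mul_pow, h3]
    nlinarith
  have h5 : |(⟪z v, h v - (m : ℂ) • v⟫_ℂ).re| ≤ ‖z‖ * ‖h v - (m : ℂ) • v‖ := by
    refine (Complex.abs_re_le_norm _).trans ((norm_inner_le_norm _ _).trans ?_)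
    gcongr
    simpa [hv] using z.le_opNorm v
  rw [h2, abs_mul, abs_mul]
  rw [abs_two, abs_neg, abs_two]
  nlinarith [norm_nonneg z]

/-- The real linear functional `T ↦ Re ⟪v, T v⟫`. -/
noncomputable def expectation (v : H) : (H →L[ℂ] H) →L[ℝ] ℝ :=
  Complex.reCLM ∘L ((innerSL ℂ v).comp (ContinuousLinearMap.apply ℂ H v)).restrictScalars ℝ

theorem expectation_apply (v : H) (T : H →L[ℂ] H) : expectation v T = (⟪v, T v⟫_ℂ).re := rfl

/-- As `m` grows, the eigenvalues of `peak` tend to the indicator of `λ_k`, because the `λ_i` are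
distinct. Dominated convergence in Parseval's sum then leaves the expectation of the rank one
projection onto `V e_k`. -/
theorem tendsto_expectation_peak (e : HilbertBasis ℕ ℂ H) {b V : H →L[ℂ] H} {lam : ℕ → ℝ}
    (hlam : Function.Injective lam) (hb : ∀ i, b (e i) = (lam i : ℂ) • e i) {R : ℝ} {k : ℕ}
    (hR : ∀ i, (lam i - lam k) ^ 2 ≤ R ^ 2) (hR0 : R ≠ 0) (hV : V ∈ unitary (H →L[ℂ] H)) :
    Tendsto (fun m => expectation (e k) (peak (lam k) R m (V * b * star V))) atTop
      (𝓝 (‖⟪e k, V (e k)⟫_ℂ‖ ^ 2)) := by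
  set w := star V (e k) with hw
  have h1 (m : ℕ) : expectation (e k) (peak (lam k) R m (V * b * star V)) =
      ∑' i, (1 - (lam i - lam k) ^ 2 / R ^ 2) ^ m * ‖⟪e i, w⟫_ℂ‖ ^ 2 := by
    rw [(hasSum_re_inner_diag e (peak_diag e hb (lam k) R m) w).tsum_eq, peak_conj _ _ _ hV,
      expectation_apply, mul_apply_eq_comp, mul_apply_eq_comp, ← hw,
      ← ContinuousLinearMap.adjoint_inner_left, ← ContinuousLinearMap.star_eq_adjoint, ← hw]
  have h2 : ‖⟪e k, V (e k)⟫_ℂ‖ ^ 2 =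
      ∑' i, (if i = k then (1 : ℝ) else 0) * ‖⟪e i, w⟫_ℂ‖ ^ 2 := by
    rw [tsum_eq_single k (fun i hi => by simp [hi]), hw, ContinuousLinearMap.star_eq_adjoint,
      ContinuousLinearMap.adjoint_inner_right, if_pos rfl, one_mul, norm_inner_symm]
  rw [h2]
  simp_rw [h1]
  have h3 (i : ℕ) : 0 ≤ 1 - (lam i - lam k) ^ 2 / R ^ 2 :=
    sub_nonneg.2 (div_le_one_of_le₀ (hR i) (sq_nonneg _))
  have h4 (i : ℕ) : 1 - (lam i - lam k) ^ 2 / R ^ 2 ≤ 1 := by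
    have : 0 ≤ (lam i - lam k) ^ 2 / R ^ 2 := by positivity
    linarith
  refine tendsto_tsum_of_dominated_convergence (hasSum_norm_sq e w).summable (fun i => ?_)
    (Eventually.of_forall fun m i => ?_)
  · refine Tendsto.mul_const _ ?_
    split_ifs with hi
    · exact tendsto_const_nhds.congr fun m => by simp [hi]
    · refine tendsto_pow_atTop_nhds_zero_of_lt_one (h3 i) ?_
      have : lam i - lam k ≠ 0 := sub_ne_zero.2 fun h => hi (hlam h)
      have : 0 < (lam i - lam k) ^ 2 / R ^ 2 := by positivity
      linarith
  · rw [Real.norm_of_nonneg (mul_nonneg (pow_nonneg (h3 i) m) (sq_nonneg _))]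
    exact mul_le_of_le_one_left (sq_nonneg _) (pow_le_one₀ (h3 i) (h4 i))

/-- A number in `[-1, 1]` stays off the endpoints after multiplication by some `c ∈ [0, 1)`. -/
theorem sq_mul_lt_one {c x : ℝ} (hc0 : 0 ≤ c) (hc1 : c < 1) (hx : x ^ 2 ≤ 1) : (c * x) ^ 2 < 1 := by
  rw [mul_pow]
  nlinarith [sq_nonneg x]

/-- The angle `arccos (c ψ) / 2`, where `ψ = 2 Re ⟪v, h v⟫ - 1`, varies at most as fast as a curve
`χ` with `0 ≤ h(χ) ≤ 1`, measured by the Finsler norm. -/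
theorem enorm_derivWithin_angle_le {χ : ℝ → H →L[ℂ] H} {I : Set ℝ} {t : ℝ} {l R c : ℝ} {m : ℕ}
    {v : H} (hI : UniqueDiffWithinAt ℝ I t) (hχ : DifferentiableWithinAt ℝ χ I t)
    (hc0 : 0 ≤ c) (hc1 : c < 1) (hv : ‖v‖ = 1)
    (hh : star (peak l R m (χ t)) = peak l R m (χ t))
    (hhv : ‖peak l R m (χ t) v‖ ^ 2 ≤ (⟪v, peak l R m (χ t) v⟫_ℂ).re)
    (hψ : (2 * expectation v (peak l R m (χ t)) - 1) ^ 2 ≤ 1) :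
    ‖derivWithin (fun s => Real.arccos (c * (2 * expectation v (peak l R m (χ s)) - 1)) / 2) I t‖ₑ
      ≤ finslerNorm (χ t) (derivWithin χ I t) := by
  -- The bound is proved for every lift `z` of the velocity; the infimum over `z` is the Finsler
  -- norm.
  refine le_iInf₂ fun z hz => ?_
  have h1 := hχ.hasDerivWithinAt
  rw [← hz.2] at h1
  have h2 := ((((expectation v).hasFDerivAt.comp_hasDerivWithinAt t
    (hasDerivWithinAt_peak l R m h1)).const_mul 2).sub_const 1).const_mul c
  set x := 2 * expectation v (peak l R m (χ t)) - 1 with hx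
  have hlt := sq_mul_lt_one hc0 hc1 hψ
  have h3 := ((Real.hasDerivAt_arccos (x := c * x) (fun h => by rw [h] at hlt; norm_num at hlt)
    (fun h => by rw [h] at hlt; norm_num at hlt)).comp_hasDerivWithinAt t h2).div_const 2
  have h4 := h3.derivWithin hI
  simp only [Function.comp_def] at h4
  rw [h4, ← ofReal_norm, ← ofReal_norm]
  refine ENNReal.ofReal_le_ofReal ?_
  have hpos : 0 < √(1 - (c * x) ^ 2) := Real.sqrt_pos.2 (by linarith)
  have h5 := abs_re_inner_commutator_le hh hz.1.2 hv hhv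
  rw [← expectation_apply, ← expectation_apply, ← hx] at h5
  -- Since `c ≤ 1`, `c²(1 - x²) ≤ 1 - c² x²`: damping by `c` does not worsen the speed estimate.
  have h6 : c * √(1 - x ^ 2) ≤ √(1 - (c * x) ^ 2) := by
    refine Real.le_sqrt_of_sq_le ?_
    rw [mul_pow, Real.sq_sqrt (by linarith)]
    nlinarith
  have h7 : c * |2 * expectation v (z * peak l R m (χ t) - peak l R m (χ t) * z)| ≤
      2 * ‖z‖ * √(1 - (c * x) ^ 2) :=
    calc _ ≤ c * (2 * ‖z‖ * √(1 - x ^ 2)) := by gcongr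
      _ = 2 * ‖z‖ * (c * √(1 - x ^ 2)) := by ring
      _ ≤ _ := by gcongr
  rw [Real.norm_eq_abs, abs_div, abs_mul, abs_neg, abs_div, abs_one, abs_of_pos hpos, abs_two,
    abs_mul, abs_of_nonneg hc0, div_le_iff₀ two_pos, one_div, inv_mul_le_iff₀ hpos]
  linarith

theorem exists_sq_sub_le (e : HilbertBasis ℕ ℂ H) {b : H →L[ℂ] H} {lam : ℕ → ℝ}
    (hb : ∀ i, b (e i) = (lam i : ℂ) • e i) (l : ℝ) :
    ∃ R : ℝ, R ≠ 0 ∧ ∀ i, (lam i - l) ^ 2 ≤ R ^ 2 := by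
  refine ⟨‖b - (l : ℂ) • 1‖ + 1, by positivity, fun i => ?_⟩
  have h := (b - (l : ℂ) • 1).le_opNorm (e i)
  have h1 : (b - (l : ℂ) • 1) (e i) = ((lam i - l : ℝ) : ℂ) • e i := by
    simp [hb, sub_smul]
  rw [h1, norm_smul, e.orthonormal.1, mul_one, mul_one, Complex.norm_real, Real.norm_eq_abs] at h
  rw [← sq_abs]
  gcongr
  linarith

/-- A smooth curve in the orbit from `b` to `V b V*` is at least as long as the angle between the
lines spanned by an eigenvector of `b` and by its image under `V`. -/
theorem le_curveLength (e : HilbertBasis ℕ ℂ H) {A b u V : H →L[ℂ] H} {lam : ℕ → ℝ}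
    (hlam : Function.Injective lam) (hb : ∀ i, b (e i) = (lam i : ℂ) • e i)
    (hu : u ∈ fredholmUnitary H) (hA : A = u * b * star u) (hV : V ∈ unitary (H →L[ℂ] H)) (k : ℕ)
    {χ : ℝ → H →L[ℂ] H} {s t : ℝ} (hst : s < t) (hχ : IsSmoothCurve A χ (Icc s t))
    (hs : χ s = b) (ht : χ t = V * b * star V) :
    ENNReal.ofReal (Real.arccos (2 * ‖⟪e k, V (e k)⟫_ℂ‖ ^ 2 - 1) / 2) ≤
      curveLength χ (Icc s t) := by
  obtain ⟨R, hR0, hR⟩ := exists_sq_sub_le e hb (lam k)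
  have hek : ‖e k‖ = 1 := e.orthonormal.1 k
  have hpeak (m : ℕ) (τ : ℝ) (hτ : τ ∈ Icc s t) :
      star (peak (lam k) R m (χ τ)) = peak (lam k) R m (χ τ) ∧
        ∀ v, ‖peak (lam k) R m (χ τ) v‖ ^ 2 ≤ (⟪v, peak (lam k) R m (χ τ) v⟫_ℂ).re := by
    obtain ⟨w, hw, hχw⟩ := hχ.1 τ hτ
    have : χ τ = (w * u) * b * star (w * u) := by
      rw [hχw, hA, star_mul]; simp only [mul_assoc]
    rw [this]
    exact peak_of_conj e hb hR m (mul_mem hw.1 hu.1)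
  -- With `x` the expectation, `x² ≤ ‖h v‖² ≤ x`, which forces `x ∈ [0, 1]`.
  have hψ (m : ℕ) (τ : ℝ) (hτ : τ ∈ Icc s t) :
      (2 * expectation (e k) (peak (lam k) R m (χ τ)) - 1) ^ 2 ≤ 1 := by
    have h1 := (hpeak m τ hτ).2 (e k)
    have h2 : |(⟪e k, peak (lam k) R m (χ τ) (e k)⟫_ℂ).re| ≤ ‖peak (lam k) R m (χ τ) (e k)‖ := by
      refine (Complex.abs_re_le_norm _).trans ((norm_inner_le_norm _ _).trans_eq ?_)
      rw [hek, one_mul]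
    rw [expectation_apply]
    have h3 := sq_le_sq' (neg_le_of_abs_le (h2.trans (le_abs_self _)))
      ((le_abs_self _).trans (h2.trans (le_abs_self _)))
    rw [sq_abs] at h3
    nlinarith
  have hc (m : ℕ) : 0 ≤ 1 - 1 / ((m : ℝ) + 1) ∧ 1 - 1 / ((m : ℝ) + 1) < 1 := by
    have h1 : 0 < 1 / ((m : ℝ) + 1) := by positivity
    have h2 : 1 / ((m : ℝ) + 1) ≤ 1 := by
      rw [div_le_one (by positivity)]
      linarith [(Nat.cast_nonneg m : (0 : ℝ) ≤ m)]
    constructor <;> linarith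
  -- The damping factor `1 - 1/(m + 1)` is tied to the sharpness `m` of the peak, so that one limit
  -- removes both. At the initial point the expectation is exactly `1`, whence the term `arccos c /
  -- 2` that is subtracted.
  have hlen (m : ℕ) : ENNReal.ofReal
      (Real.arccos ((1 - 1 / ((m : ℝ) + 1)) *
          (2 * expectation (e k) (peak (lam k) R m (V * b * star V)) - 1)) / 2 -
        Real.arccos (1 - 1 / ((m : ℝ) + 1)) / 2) ≤ curveLength χ (Icc s t) := by
    set c := 1 - 1 / ((m : ℝ) + 1)
    set Θ : ℝ → ℝ := fun τ =>
      Real.arccos (c * (2 * expectation (e k) (peak (lam k) R m (χ τ)) - 1)) / 2 with hΘ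
    have h0 : Θ s = Real.arccos c / 2 := by
      simp only [hΘ]
      rw [hs, expectation_apply, peak_diag e hb, sub_self]
      norm_num [hek]
    have hsm : ContDiffOn ℝ 1 Θ (Icc s t) := by
      refine ContDiffOn.div_const (fun τ hτ => ?_) 2
      have hlt := sq_mul_lt_one (hc m).1 (hc m).2 (hψ m τ hτ)
      refine ContDiffAt.comp_contDiffWithinAt (g := Real.arccos) τ (Real.contDiffAt_arccos
        (fun h => by rw [h] at hlt; norm_num at hlt)
        (fun h => by rw [h] at hlt; norm_num at hlt)) ?_
      exact (contDiffWithinAt_const.mul ((contDiffWithinAt_const.mul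
        ((expectation (e k)).contDiff.comp_contDiffWithinAt
          (contDiffOn_peak (lam k) R m hχ.2 τ hτ))).sub contDiffWithinAt_const))
    have h1 : ENNReal.ofReal (Θ t - Θ s) ≤ ‖Θ t - Θ s‖ₑ := by
      rw [← ofReal_norm]
      exact ENNReal.ofReal_le_ofReal (le_abs_self _)
    rw [← h0]
    have h2 : Real.arccos (c * (2 * expectation (e k) (peak (lam k) R m (V * b * star V)) - 1)) / 2
        = Θ t := by rw [← ht]
    rw [h2]
    refine h1.trans ((enorm_sub_le_lintegral_derivWithin_Icc_of_contDiffOn_Icc hsm hst.le).trans ?_)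
    refine setLIntegral_mono' measurableSet_Icc fun τ hτ => ?_
    exact enorm_derivWithin_angle_le (uniqueDiffOn_Icc hst τ hτ)
      ((hχ.2.differentiableOn one_ne_zero) τ hτ) (hc m).1 (hc m).2 hek (hpeak m τ hτ).1
      ((hpeak m τ hτ).2 _) (hψ m τ hτ)
  -- The subtracted term tends to `arccos 1 / 2 = 0`.
  refine le_of_tendsto (x := (atTop : Filter ℕ)) (ENNReal.continuous_ofReal.continuousAt.tendsto.comp ?_)
    (Eventually.of_forall hlen)
  have hct : Tendsto (fun m : ℕ => 1 - 1 / ((m : ℝ) + 1)) atTop (𝓝 1) := by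
    simpa using tendsto_one_div_add_atTop_nhds_zero_nat.const_sub (1 : ℝ)
  have h1 := ((Real.continuous_arccos.tendsto _).comp (hct.mul
    (((tendsto_expectation_peak e hlam hb hR hR0 hV).const_mul 2).sub_const 1))).div_const 2
  have h2 := ((Real.continuous_arccos.tendsto _).comp hct).div_const 2
  simpa using h1.sub h2

end Minimality

section Block

variable {H : Type*} [NormedAddCommGroup H] [InnerProductSpace ℂ H] [CompleteSpace H]

/-! ### Skew operators that decouple on a plane -/

theorem norm_sq_plane_add {a f y : H} (ha : ‖a‖ = 1) (haf : ⟪a, f⟫_ℂ = 0) (hay : ⟪a, y⟫_ℂ = 0)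
    (hfy : ⟪f, y⟫_ℂ = 0) (p q : ℂ) :
    ‖p • a + q • f + y‖ ^ 2 = ‖p‖ ^ 2 + ‖q‖ ^ 2 * ‖f‖ ^ 2 + ‖y‖ ^ 2 := by
  have h1 := norm_add_sq_eq_norm_sq_add_norm_sq_of_inner_eq_zero (𝕜 := ℂ) (p • a + q • f) y
    (by simp [inner_add_left, inner_smul_left, hay, hfy])
  have h2 := norm_add_sq_eq_norm_sq_add_norm_sq_of_inner_eq_zero (𝕜 := ℂ) (p • a) (q • f)
    (by simp [inner_smul_left, inner_smul_right, haf])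
  simp only [norm_smul, ha, mul_one] at h1 h2
  nlinarith

/-- The skew operator that maps `a` to `f` and `f` to a multiple of `-a`, plus `W`. -/
noncomputable def planeSkew (a f : H) (W : H →L[ℂ] H) : H →L[ℂ] H :=
  InnerProductSpace.rankOne ℂ f a - InnerProductSpace.rankOne ℂ a f + W

theorem planeSkew_apply (a f : H) (W : H →L[ℂ] H) (x : H) :
    planeSkew a f W x = ⟪a, x⟫_ℂ • f - ⟪f, x⟫_ℂ • a + W x := by
  simp [planeSkew]

/-- The plane of `a` and `f` reduces the operator: on it the operator is `M` times an isometry, and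
on its orthogonal complement it equals `W`, which preserves the complement because it is skew and
kills the plane. Pythagoras combines the two. -/
theorem norm_planeSkew_le {a f : H} {W : H →L[ℂ] H} {M : ℝ} (hM : 0 < M) (ha : ‖a‖ = 1)
    (hf : ‖f‖ = M) (haf : ⟪a, f⟫_ℂ = 0) (hW : star W = -W) (hWa : W a = 0) (hWf : W f = 0)
    (hWM : ‖W‖ ≤ M) : ‖planeSkew a f W‖ ≤ M := by
  refine (planeSkew a f W).opNorm_le_bound hM.le fun x => ?_
  refine (sq_le_sq₀ (norm_nonneg _) (by positivity)).1 ?_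
  have hfa : ⟪f, a⟫_ℂ = 0 := inner_eq_zero_symm.1 haf
  have haa : ⟪a, a⟫_ℂ = 1 := by simp [inner_self_eq_norm_sq_to_K, ha]
  have hff : ⟪f, f⟫_ℂ = (M : ℂ) ^ 2 := by simp [inner_self_eq_norm_sq_to_K, hf]
  have hM' : (M : ℂ) ≠ 0 := by exact_mod_cast hM.ne'
  -- Coordinates along `a` and `f`; the vector `f` has norm `M`, hence the division by `M²`.
  set α := ⟪a, x⟫_ℂ with hα
  set β := ⟪f, x⟫_ℂ / (M : ℂ) ^ 2 with hβ
  have hβ' : ⟪f, x⟫_ℂ = β * (M : ℂ) ^ 2 := by rw [hβ]; field_simp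
  set y := x - α • a - β • f with hy
  have hx : x = α • a + β • f + y := by rw [hy]; abel
  have hay : ⟪a, y⟫_ℂ = 0 := by
    simp only [hy, inner_sub_right, inner_smul_right, haa, haf, ← hα]; ring
  have hfy : ⟪f, y⟫_ℂ = 0 := by
    simp only [hy, inner_sub_right, inner_smul_right, hff, hfa, hβ']; ring
  have horth (v : H) (hv : W v = 0) : ⟪v, W y⟫_ℂ = 0 := by
    rw [← ContinuousLinearMap.adjoint_inner_left, ← ContinuousLinearMap.star_eq_adjoint, hW]
    simp [hv]
  have hZ : planeSkew a f W x = (-(β * (M : ℂ) ^ 2)) • a + α • f + W y := by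
    have hWx : W x = W y := by rw [hy]; simp [hWa, hWf]
    rw [planeSkew_apply, hWx, ← hα, hβ']
    module
  have h1 := norm_sq_plane_add ha haf hay hfy α β
  rw [← hx, hf] at h1
  rw [hZ, mul_pow, h1, norm_sq_plane_add ha haf (horth a hWa) (horth f hWf), norm_neg, norm_mul,
    norm_pow, Complex.norm_real, Real.norm_of_nonneg hM.le, hf]
  have h2 : ‖W y‖ ^ 2 ≤ M ^ 2 * ‖y‖ ^ 2 := by
    rw [← mul_pow]
    exact pow_le_pow_left₀ (norm_nonneg _) ((W.le_opNorm y).trans (by gcongr)) 2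
  nlinarith

theorem exp_apply_of_apply_eq_smul {T : H →L[ℂ] H} {x : H} {μ : ℂ} (h : T x = μ • x) :
    NormedSpace.exp T x = Complex.exp μ • x := by
  have h1 := (NormedSpace.exp_series_hasSum_exp' (𝕂 := ℂ) T).mapL
    (ContinuousLinearMap.apply ℂ H x)
  have h2 := (NormedSpace.exp_series_hasSum_exp' (𝕂 := ℂ) μ).smul_const x
  rw [← Complex.exp_eq_exp_ℂ] at h2
  have hp (n : ℕ) : (T ^ n) x = μ ^ n • x := by
    induction n with
    | zero => simp
    | succ k ih => rw [pow_succ, mul_apply_eq_comp, h, map_smul, ih, smul_smul, pow_succ']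
  refine HasSum.unique (h1.congr_fun fun n => ?_) h2
  simp [hp, smul_smul]

/-- The vectors `a - (c/M) f` with `c = ±i` are eigenvectors of the plane block with eigenvalues
`cM`, and `a` is their mean; the two exponentials average to a cosine. -/
theorem inner_exp_planeSkew {a f : H} {W : H →L[ℂ] H} {M : ℝ} (hM : 0 < M) (ha : ‖a‖ = 1)
    (hf : ‖f‖ = M) (haf : ⟪a, f⟫_ℂ = 0) (hWa : W a = 0) (hWf : W f = 0) (t : ℝ) :
    ⟪a, NormedSpace.exp ((t : ℂ) • planeSkew a f W) a⟫_ℂ = Real.cos (t * M) := by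
  have hfa : ⟪f, a⟫_ℂ = 0 := inner_eq_zero_symm.1 haf
  have haa : ⟪a, a⟫_ℂ = 1 := by simp [inner_self_eq_norm_sq_to_K, ha]
  have hff : ⟪f, f⟫_ℂ = (M : ℂ) ^ 2 := by simp [inner_self_eq_norm_sq_to_K, hf]
  have hM' : (M : ℂ) ≠ 0 := by exact_mod_cast hM.ne'
  have hZa : planeSkew a f W a = f := by
    rw [planeSkew_apply, haa, hfa, hWa]; module
  have hZf : planeSkew a f W f = -(M : ℂ) ^ 2 • a := by
    rw [planeSkew_apply, haf, hff, hWf]; module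
  have key (c : ℂ) (hc : c ^ 2 = -1) : ((t : ℂ) • planeSkew a f W) (a - (c / M) • f) =
      ((t : ℂ) * (c * M)) • (a - (c / M) • f) := by
    rw [smul_apply, map_sub, map_smul, hZa, hZf]
    have h1 : (t : ℂ) * (c * M) * (c / M) = -t := by
      field_simp
      rw [hc]; ring
    have h2 : c / M * -(M : ℂ) ^ 2 = -(c * M) := by field_simp
    rw [smul_sub _ a, smul_smul _ (c / (M : ℂ)) f, h1, smul_smul, h2]
    module
  have hI : Complex.I ^ 2 = -1 := Complex.I_sq
  have e1 := exp_apply_of_apply_eq_smul (key Complex.I hI)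
  have e2 := exp_apply_of_apply_eq_smul (key (-Complex.I) (by rw [neg_sq, hI]))
  have hsum : a = (2⁻¹ : ℂ) • ((a - (Complex.I / M) • f) + (a - (-Complex.I / M) • f)) := by
    rw [neg_div]; module
  have h3 : NormedSpace.exp ((t : ℂ) • planeSkew a f W) a = (2⁻¹ : ℂ) •
      (Complex.exp ((t : ℂ) * (Complex.I * M)) • (a - (Complex.I / M) • f) +
        Complex.exp ((t : ℂ) * (-Complex.I * M)) • (a - (-Complex.I / M) • f)) := by
    rw [← e1, ← e2, ← map_add, ← map_smul, ← hsum]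
  rw [h3]
  simp only [inner_smul_right, inner_add_right, inner_sub_right, haa, haf, mul_zero, sub_zero,
    mul_one]
  rw [Complex.ofReal_cos, Complex.cos]
  push_cast
  ring_nf

end Block

section Projections

variable {H : Type*} [NormedAddCommGroup H] [InnerProductSpace ℂ H] [CompleteSpace H]

/-! ### Compressions to the span of the first basis vectors -/

theorem proj_basis (e : HilbertBasis ℕ ℂ H) (n j : ℕ) :
    proj e n (e j) = (if j < n then (1 : ℂ) else 0) • e j := by
  simp only [proj, sum_apply, InnerProductSpace.rankOne_apply,
    orthonormal_iff_ite.1 e.orthonormal, ite_smul, one_smul, zero_smul]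
  simp

theorem inner_compression (e : HilbertBasis ℕ ℂ H) (T : H →L[ℂ] H) (n i j : ℕ) :
    ⟪e i, (proj e n * T * proj e n) (e j)⟫_ℂ = if i < n ∧ j < n then ⟪e i, T (e j)⟫_ℂ else 0 := by
  rw [mul_apply_eq_comp, mul_apply_eq_comp, inner_diag e (proj_basis e n), proj_basis, map_smul,
    inner_smul_right]
  by_cases hi : i < n <;> by_cases hj : j < n <;> simp [hi, hj]

theorem norm_proj_le (e : HilbertBasis ℕ ℂ H) (n : ℕ) : ‖proj e n‖ ≤ 1 :=
  norm_diag_le e (proj_basis e n) zero_le_one fun i => by split_ifs <;> simp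

theorem isCompactOperator_rankOne (x y : H) :
    IsCompactOperator (InnerProductSpace.rankOne ℂ x y : H →L[ℂ] H) := by
  have h : IsCompactOperator (innerSL ℂ y : H →L[ℂ] ℂ) :=
    isCompactOperator_of_locallyCompactSpace_dom _
  exact h.clm_comp (ContinuousLinearMap.toSpanSingleton ℂ x)

theorem isCompactOperator_proj (e : HilbertBasis ℕ ℂ H) (n : ℕ) :
    IsCompactOperator (proj e n : H →L[ℂ] H) :=
  (compactOperator (RingHom.id ℂ) H H).sum_mem fun _ _ => isCompactOperator_rankOne _ _

theorem isCompactOperator_compression (e : HilbertBasis ℕ ℂ H) (T : H →L[ℂ] H) (n : ℕ) :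
    IsCompactOperator (proj e n * T * proj e n : H →L[ℂ] H) :=
  isCompactOperator_mul_left (isCompactOperator_proj e n) _

theorem commute_proj_compression (e : HilbertBasis ℕ ℂ H) (T : H →L[ℂ] H) (n : ℕ) :
    Commute (proj e n) (proj e n * T * proj e n) := by
  have h : proj e n * proj e n = proj e n := ext_basis e fun j => by
    simp only [mul_apply_eq_comp, proj_basis, map_smul, smul_smul]
    split_ifs <;> simp
  rw [Commute, SemiconjBy, ← mul_assoc, ← mul_assoc, h, mul_assoc _ (proj e n), h]

/-- Absolutely summable entries make the expansion into rank one operators converge in norm. The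
compressions are its partial sums over the squares `[0, n)²`, which exhaust the index set. -/
theorem tendsto_compression (e : HilbertBasis ℕ ℂ H) {T : H →L[ℂ] H}
    (h : Summable fun p : ℕ × ℕ => ‖⟪e p.1, T (e p.2)⟫_ℂ‖) :
    Tendsto (fun n => proj e n * T * proj e n) atTop (𝓝 T) := by
  have ho := orthonormal_iff_ite.1 e.orthonormal
  have hs : Summable fun p : ℕ × ℕ =>
      ⟪e p.1, T (e p.2)⟫_ℂ • InnerProductSpace.rankOne ℂ (e p.1) (e p.2) :=
    Summable.of_norm (by simpa [norm_smul, e.orthonormal.1] using h)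
  have hT : HasSum (fun p : ℕ × ℕ =>
      ⟪e p.1, T (e p.2)⟫_ℂ • InnerProductSpace.rankOne ℂ (e p.1) (e p.2)) T := by
    convert hs.hasSum using 1
    refine ext_entries e fun i j => ?_
    have h1 := ((hs.hasSum.mapL (ContinuousLinearMap.apply ℂ H (e j))).mapL
      (innerSL ℂ (e i))).tsum_eq
    simp only [ContinuousLinearMap.apply_apply, innerSL_apply_apply] at h1
    rw [← h1, tsum_eq_single (i, j)]
    · simp [inner_smul_right, e.orthonormal.1]
    · rintro ⟨k, l⟩ hkl
      simp only [ne_eq, Prod.mk.injEq, not_and_or] at hkl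
      simp only [smul_apply, InnerProductSpace.rankOne_apply, inner_smul_right, ho]
      rcases hkl with hkl | hkl
      · simp [Ne.symm hkl]
      · simp [hkl]
  have hmono : Monotone fun n : ℕ => Finset.range n ×ˢ Finset.range n := fun m n hmn =>
    Finset.product_subset_product (Finset.range_mono hmn) (Finset.range_mono hmn)
  have hat : Tendsto (fun n : ℕ => Finset.range n ×ˢ Finset.range n) atTop atTop :=
    tendsto_atTop_finset_of_monotone hmono fun p => ⟨max p.1 p.2 + 1, by
      simp only [Finset.mem_product, Finset.mem_range]; omega⟩
  refine (hT.comp hat).congr fun n => ext_entries e fun i j => ?_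
  rw [inner_compression, Function.comp_apply, Finset.sum_product, sum_apply, inner_sum]
  simp only [sum_apply, smul_apply, InnerProductSpace.rankOne_apply, ho, ite_smul, one_smul,
    zero_smul, smul_ite, smul_zero, Finset.sum_ite_eq', Finset.mem_range]
  by_cases hj : j < n
  · simp [hj, inner_smul_right, ho]
  · simp [hj]

theorem summable_of_bound (a : ℕ → ℕ → ℂ) (C ρ : ℝ) (h0 : 0 ≤ ρ) (h1 : ρ < 1)
    (h : ∀ i j, ‖a i j‖ ≤ C * (ρ ^ i * ρ ^ j)) : Summable fun p : ℕ × ℕ => ‖a p.1 p.2‖ := by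
  have hg := summable_geometric_of_lt_one h0 h1
  exact Summable.of_nonneg_of_le (fun _ => norm_nonneg _) (fun p => h p.1 p.2)
    ((hg.mul_of_nonneg hg (fun _ => pow_nonneg h0 _) (fun _ => pow_nonneg h0 _)).mul_left C)

theorem star_eq_neg_of_real_symm (e : HilbertBasis ℕ ℂ H) {T : H →L[ℂ] H} {a : ℕ → ℕ → ℝ}
    (h : ∀ i j, ⟪e i, T (e j)⟫_ℂ = Complex.I * a i j) (ha : ∀ i j, a i j = a j i) :
    star T = -T :=
  star_eq_neg_of_entries e fun i j => by
    rw [h, h, ha j i]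
    simp

theorem star_compression (e : HilbertBasis ℕ ℂ H) {T : H →L[ℂ] H} (hT : star T = -T) (n : ℕ) :
    star (proj e n * T * proj e n) = -(proj e n * T * proj e n) := by
  have h : star (proj e n) = proj e n :=
    star_diag_real e (d := fun j => if j < n then 1 else 0) fun j => by
      rw [proj_basis]; split_ifs <;> simp
  rw [star_mul, star_mul, h, hT]
  noncomm_ring

end Projections

/-! ### The entries of the matrices -/

theorem entryL_succ_one (γ : ℝ) (i : ℕ) : entryL γ (i + 1) 1 = if i = 0 then 0 else γ ^ i := by
  by_cases hi : i = 0 <;> simp [entryL, hi]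

theorem entryL_symm (γ : ℝ) (i j : ℕ) : entryL γ i j = entryL γ j i := by
  by_cases hi : i = 1 <;> by_cases hj : j = 1 <;> simp [entryL, hi, hj]

theorem entryL_succ_succ (γ : ℝ) (i j : ℕ) : entryL γ (i + 1 + 1) (j + 1 + 1) = 0 := by
  simp [entryL]

theorem entryY_symm (γ : ℝ) (i j : ℕ) : entryY γ i j = entryY γ j i := by
  simp only [entryY, max_comm i j, eq_comm (a := i) (b := j), or_left_comm (a := i = 1)]

theorem abs_entryL_le {γ : ℝ} (i j : ℕ) :
    |entryL γ (i + 1) (j + 1)| ≤ |γ| ^ i * |γ| ^ j := by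
  simp only [entryL]
  split_ifs with h h' <;> simp_all [abs_pow]
  positivity

/-- Because `2 max(i, j) ≥ i + j`, decay in the maximum gives product decay at rate `√|γ|`; the
factor `|γ|⁻¹` compensates the exponent `max(i, j) - 1`. -/
theorem abs_entryY_le {γ : ℝ} (hγ0 : γ ≠ 0) (hγ1 : |γ| < 1) (i j : ℕ) :
    |entryY γ (i + 1) (j + 1)| ≤ |γ|⁻¹ * (√|γ| ^ i * √|γ| ^ j) := by
  have hp : 0 < |γ| := abs_pos.2 hγ0
  simp only [entryY]
  split_ifs with h
  · simp only [abs_zero]; positivity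
  · have h2 : |γ| ^ (max (i + 1) (j + 1) - 2) = |γ|⁻¹ * √|γ| ^ (2 * max i j) := by
      rw [pow_mul, Real.sq_sqrt hp.le, eq_inv_mul_iff_mul_eq₀ hp.ne', ← pow_succ']
      congr 1
      omega
    rw [abs_pow, h2, ← pow_add]
    exact mul_le_mul_of_nonneg_left (pow_le_pow_of_le_one (Real.sqrt_nonneg _)
      (Real.sqrt_le_one.2 hγ1.le) (by omega)) (by positivity)

/-- The entries, numbered from `0`, of `-i (P_n Y^[1] P_n + D_n)`. -/
def entryW (γ : ℝ) (n i j : ℕ) : ℝ :=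
  (if i < n ∧ j < n then entryY γ (i + 1) (j + 1) else 0) +
    if i = j then entryDn γ n (j + 1) else 0

theorem entryW_zero_right (γ : ℝ) (n i : ℕ) : entryW γ n i 0 = 0 := by
  simp [entryW, entryY, entryDn]

/-- The truncated first column is in the kernel of `P_n Y^[1] P_n + D_n`. -/
theorem sum_entryW_mul_pow (γ : ℝ) (N i : ℕ) :
    ∑ j ∈ Finset.range N, γ ^ (j + 1) * entryW γ (N + 1) i (j + 1) = 0 := by
  rcases i with _ | k
  · refine Finset.sum_eq_zero fun j _ => ?_
    simp [entryW, entryY]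
  rcases le_or_gt N k with hk | hk
  · refine Finset.sum_eq_zero fun j hj => ?_
    rw [Finset.mem_range] at hj
    rw [entryW, if_neg (by omega), if_neg (by omega), add_zero, mul_zero]
  obtain ⟨p, rfl⟩ : ∃ p, N = k + 1 + p := ⟨N - (k + 1), by omega⟩
  -- The row is split at the diagonal. Both off-diagonal parts contain the factor `γ^(k+1)` that
  -- multiplies the diagonal entry, and that entry is minus the sum of what remains.
  rw [Finset.sum_range_add, Finset.sum_range_succ]
  have h1 : ∑ j ∈ Finset.range k, γ ^ (j + 1) * entryW γ (k + 1 + p + 1) (k + 1) (j + 1) =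
      ∑ j ∈ Finset.range k, γ ^ (k + 1) * γ ^ j := by
    refine Finset.sum_congr rfl fun j hj => ?_
    rw [Finset.mem_range] at hj
    rw [entryW, if_pos (by omega), if_neg (by omega), entryY, if_neg (by omega), add_zero,
      ← pow_add, ← pow_add]
    congr 1
    omega
  have h2 : ∑ x ∈ Finset.range p,
      γ ^ (k + 1 + x + 1) * entryW γ (k + 1 + p + 1) (k + 1) (k + 1 + x + 1) =
      ∑ x ∈ Finset.range p, γ ^ (k + 1) * γ ^ (2 * (k + 1 + 1 + x) - (k + 1 + 1)) := by
    refine Finset.sum_congr rfl fun x hx => ?_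
    rw [Finset.mem_range] at hx
    rw [entryW, if_pos (by omega), if_neg (by omega), entryY, if_neg (by omega), add_zero,
      ← pow_add, ← pow_add]
    congr 1
    omega
  have h3 : entryW γ (k + 1 + p + 1) (k + 1) (k + 1) = -(∑ j ∈ Finset.range k, γ ^ j) -
      ∑ x ∈ Finset.range p, γ ^ (2 * (k + 1 + 1 + x) - (k + 1 + 1)) := by
    rw [entryW, if_pos (by omega), if_pos rfl, entryY, if_pos (by omega), zero_add, entryDn,
      if_neg (by omega), Finset.sum_Ico_eq_sum_range,
      show k + 1 + p + 1 - (k + 1 + 1) = p by omega, show k + 1 + 1 - 2 = k by omega]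
  rw [h1, h2, h3, ← Finset.mul_sum, ← Finset.mul_sum]
  ring

/-- Inside the truncation the difference is a geometric tail. Outside it `entryDn` vanishes, and the
shift by `1/(1 - γ)` cancels the limit of `entryD`, leaving terms of size `|γ|^k` with `k ≥ N`. -/
theorem abs_entryDn_sub_entryD_le {γ : ℝ} (hγ1 : |γ| < 1) (N j : ℕ) :
    |entryDn γ (N + 1) (j + 1) + (if j < N + 1 then 1 / (1 - γ) else 0) -
      (entryD γ (j + 1) + 1 / (1 - γ))| ≤ (1 / (1 - γ) + 1 / (1 - γ ^ 2)) * |γ| ^ N := by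
  obtain ⟨h1, h2⟩ := abs_lt.1 hγ1
  have hγ2 : γ ^ 2 < 1 := (sq_lt_one_iff_abs_lt_one γ).2 hγ1
  have hp1 : 0 < 1 / (1 - γ) := one_div_pos.2 (by linarith)
  have hp2 : 0 < 1 / (1 - γ ^ 2) := one_div_pos.2 (by linarith)
  have hne1 : 1 - γ ≠ 0 := by linarith
  have hne2 : 1 - γ ^ 2 ≠ 0 := by linarith
  have hle {m : ℕ} (hm : N ≤ m) : |γ ^ m| ≤ |γ| ^ N := by
    rw [abs_pow]
    exact pow_le_pow_of_le_one (abs_nonneg _) hγ1.le hm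
  have hN : 0 ≤ |γ| ^ N := by positivity
  rcases j with _ | k
  · have : entryDn γ (N + 1) (0 + 1) + (if 0 < N + 1 then 1 / (1 - γ) else 0) -
        (entryD γ (0 + 1) + 1 / (1 - γ)) = 0 := by simp [entryDn, entryD]
    rw [this, abs_zero]
    positivity
  rcases lt_or_ge (k + 1) (N + 1) with hk | hk
  · obtain ⟨p, rfl⟩ : ∃ p, N = k + 1 + p := ⟨N - (k + 1), by omega⟩
    have hsum : ∑ x ∈ Finset.range p, γ ^ (2 * (k + 1 + 1 + x) - (k + 1 + 1)) =
        γ ^ (k + 2) * ((1 - γ ^ (2 * p)) / (1 - γ ^ 2)) := by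
      have h4 : ∀ x ∈ Finset.range p, γ ^ (2 * (k + 1 + 1 + x) - (k + 1 + 1)) =
          γ ^ (k + 2) * (γ ^ 2) ^ x := fun x _ => by
        rw [← pow_mul, ← pow_add]
        congr 1
        omega
      have hne3 : γ ^ 2 - 1 ≠ 0 := by linarith
      rw [Finset.sum_congr rfl h4, ← Finset.mul_sum, geom_sum_eq (by linarith), pow_mul,
        show ((γ ^ 2) ^ p - 1) / (γ ^ 2 - 1) = (1 - (γ ^ 2) ^ p) / (1 - γ ^ 2) by
          rw [div_eq_div_iff hne3 hne2]; ring]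
    have h3 : entryDn γ (k + 1 + p + 1) (k + 1 + 1) +
        (if k + 1 < k + 1 + p + 1 then 1 / (1 - γ) else 0) -
        (entryD γ (k + 1 + 1) + 1 / (1 - γ)) = γ ^ (k + 2 + 2 * p) * (1 / (1 - γ ^ 2)) := by
      rw [if_pos hk, entryDn, if_neg (by omega), entryD, if_neg (by omega),
        Finset.sum_Ico_eq_sum_range, show k + 1 + p + 1 - (k + 1 + 1) = p by omega,
        show k + 1 + 1 - 2 = k by omega, hsum, geom_sum_eq (by linarith), pow_add]
      have hne3 : γ - 1 ≠ 0 := by linarith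
      rw [show (γ ^ k - 1) / (γ - 1) = (1 - γ ^ k) / (1 - γ) by
        rw [div_eq_div_iff hne3 hne1]; ring]
      ring
    rw [h3, abs_mul, abs_of_pos hp2]
    have := hle (m := k + 2 + 2 * p) (by omega)
    nlinarith
  · have h3 : entryDn γ (N + 1) (k + 1 + 1) + (if k + 1 < N + 1 then 1 / (1 - γ) else 0) -
        (entryD γ (k + 1 + 1) + 1 / (1 - γ)) =
        γ ^ (k + 2) * (1 / (1 - γ ^ 2)) - γ ^ k * (1 / (1 - γ)) := by
      rw [if_neg (by omega), entryDn, if_pos (by omega), entryD, if_neg (by omega),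
        show k + 1 + 1 - 2 = k by omega]
      ring
    rw [h3]
    refine (abs_sub _ _).trans ?_
    rw [abs_mul, abs_mul, abs_of_pos hp1, abs_of_pos hp2]
    have a1 := hle (m := k + 2) (by omega)
    have a2 := hle (m := k) (by omega)
    nlinarith

section Operators

variable {H : Type*} [NormedAddCommGroup H] [InnerProductSpace ℂ H] [CompleteSpace H]

/-! ### The operators `L`, `Y^[1]`, `D₀`, `D_n` and their limits -/

theorem star_opL (e : HilbertBasis ℕ ℂ H) {γ : ℝ} (hγ1 : |γ| < 1) :
    star (opL e γ) = -opL e γ :=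
  star_eq_neg_of_real_symm e (opL_spec e hγ1) fun _ _ => entryL_symm _ _ _

theorem star_opY1 (e : HilbertBasis ℕ ℂ H) {γ : ℝ} (hγ0 : γ ≠ 0) (hγ1 : |γ| < 1) :
    star (opY1 e γ) = -opY1 e γ :=
  star_eq_neg_of_real_symm e (opY1_spec e hγ0 hγ1) fun _ _ => entryY_symm _ _ _

theorem star_opD0 (e : HilbertBasis ℕ ℂ H) {γ : ℝ} (hγ0 : γ ≠ 0) (hγ1 : |γ| < 1) :
    star (opD0 e γ) = -opD0 e γ :=
  star_eq_neg_of_real_symm e (a := fun i j => if i = j then entryD γ (j + 1) else 0)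
    (fun i j => by rw [opD0_spec e hγ0 hγ1]; split_ifs <;> simp)
    fun i j => by
      by_cases h : i = j
      · simp [h]
      · simp [h, Ne.symm h]

theorem star_opDn (e : HilbertBasis ℕ ℂ H) (γ : ℝ) (n : ℕ) :
    star (opDn e γ n) = -opDn e γ n :=
  star_eq_neg_of_real_symm e (a := fun i j => if i = j then entryDn γ n (j + 1) else 0)
    (fun i j => by rw [opDn_spec]; split_ifs <;> simp)
    fun i j => by
      by_cases h : i = j
      · simp [h]
      · simp [h, Ne.symm h]

theorem opD0_basis (e : HilbertBasis ℕ ℂ H) {γ : ℝ} (hγ0 : γ ≠ 0) (hγ1 : |γ| < 1) (j : ℕ) :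
    opD0 e γ (e j) = (Complex.I * entryD γ (j + 1)) • e j :=
  apply_eq_smul_of_entries e (opD0_spec e hγ0 hγ1) j

theorem opDn_basis (e : HilbertBasis ℕ ℂ H) (γ : ℝ) (n j : ℕ) :
    opDn e γ n (e j) = (Complex.I * entryDn γ n (j + 1)) • e j :=
  apply_eq_smul_of_entries e (opDn_spec e γ n) j

theorem opDn_mem_compactSkew (e : HilbertBasis ℕ ℂ H) (γ : ℝ) (n : ℕ) :
    opDn e γ n ∈ compactSkew H := by
  refine ⟨?_, star_opDn e γ n⟩
  -- `D_n` is supported on the first `n` basis vectors, so compactness is inherited from `proj e n`.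
  have h : opDn e γ n = proj e n * opDn e γ n := ext_basis e fun j => by
    rw [mul_apply_eq_comp, opDn_basis, map_smul, proj_basis]
    by_cases hj : j < n
    · simp [hj]
    · simp [entryDn, show n < j + 1 by omega]
  rw [h]
  exact isCompactOperator_mul_right (isCompactOperator_proj e n) _

theorem opDn_offDiag (e : HilbertBasis ℕ ℂ H) (γ : ℝ) (n : ℕ) {i j : ℕ} (hij : i ≠ j) :
    ⟪e i, opDn e γ n (e j)⟫_ℂ = 0 := by
  rw [opDn_spec, if_neg hij]

theorem tendsto_compression_opL (e : HilbertBasis ℕ ℂ H) {γ : ℝ} (hγ1 : |γ| < 1) :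
    Tendsto (fun n => proj e n * opL e γ * proj e n) atTop (𝓝 (opL e γ)) :=
  tendsto_compression e <| summable_of_bound (fun i j => ⟪e i, opL e γ (e j)⟫_ℂ) 1 |γ|
    (abs_nonneg _) hγ1 fun i j => by
      rw [opL_spec e hγ1, norm_mul, Complex.norm_I, one_mul, one_mul, Complex.norm_real]
      exact abs_entryL_le i j

theorem tendsto_compression_opY1 (e : HilbertBasis ℕ ℂ H) {γ : ℝ} (hγ0 : γ ≠ 0) (hγ1 : |γ| < 1) :
    Tendsto (fun n => proj e n * opY1 e γ * proj e n) atTop (𝓝 (opY1 e γ)) :=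
  tendsto_compression e <| summable_of_bound (fun i j => ⟪e i, opY1 e γ (e j)⟫_ℂ) |γ|⁻¹ √|γ|
    (Real.sqrt_nonneg _) ((Real.sqrt_lt' one_pos).2 (by simpa using hγ1)) fun i j => by
      rw [opY1_spec e hγ0 hγ1, norm_mul, Complex.norm_I, one_mul, Complex.norm_real]
      exact abs_entryY_le hγ0 hγ1 i j

theorem tendsto_opDn_add_proj (e : HilbertBasis ℕ ℂ H) {γ : ℝ} (hγ0 : γ ≠ 0) (hγ1 : |γ| < 1) :
    Tendsto (fun n => opDn e γ n + (Complex.I / (1 - (γ : ℂ))) • proj e n) atTop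
      (𝓝 (opD0 e γ + (Complex.I / (1 - (γ : ℂ))) • 1)) := by
  rw [← tendsto_add_atTop_iff_nat 1, tendsto_iff_norm_sub_tendsto_zero]
  have hγ2 : γ ^ 2 < 1 := (sq_lt_one_iff_abs_lt_one γ).2 hγ1
  have hC : 0 ≤ 1 / (1 - γ) + 1 / (1 - γ ^ 2) := by
    have h1 : 0 < 1 / (1 - γ) := one_div_pos.2 (by linarith [(abs_lt.1 hγ1).2])
    have h2 : 0 < 1 / (1 - γ ^ 2) := one_div_pos.2 (by linarith)
    linarith
  have hlim : Tendsto (fun N => (1 / (1 - γ) + 1 / (1 - γ ^ 2)) * |γ| ^ N) atTop (𝓝 0) := by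
    simpa only [mul_zero] using
      (tendsto_pow_atTop_nhds_zero_of_lt_one (abs_nonneg γ) hγ1).const_mul _
  refine squeeze_zero (fun _ => norm_nonneg _) (fun N => ?_) hlim
  refine norm_diag_le e (d := fun j => Complex.I * ((entryDn γ (N + 1) (j + 1) +
    (if j < N + 1 then 1 / (1 - γ) else 0) - (entryD γ (j + 1) + 1 / (1 - γ)) : ℝ) : ℂ))
    (fun j => ?_) (mul_nonneg hC (by positivity)) (fun j => ?_)
  · simp only [sub_apply, add_apply, smul_apply, one_apply_eq_self, opDn_basis,
      opD0_basis e hγ0 hγ1, proj_basis, smul_smul, ← add_smul, ← sub_smul]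
    congr 1
    split_ifs <;> push_cast <;> ring
  · rw [norm_mul, Complex.norm_I, one_mul, Complex.norm_real]
    exact abs_entryDn_sub_entryD_le hγ1 N j

end Operators

section FirstColumn

variable {H : Type*} [NormedAddCommGroup H] [InnerProductSpace ℂ H] [CompleteSpace H]

/-! ### The first column determines the quotient norm -/

/-- `D e₀` is parallel to `e₀` and `Y e₀` is orthogonal to it, so adding `D` can only lengthen the
first column. -/
theorem norm_first_column_le (e : HilbertBasis ℕ ℂ H) {Y D : H →L[ℂ] H}
    (hY : ⟪e 0, Y (e 0)⟫_ℂ = 0) (hD : ∀ i j, i ≠ j → ⟪e i, D (e j)⟫_ℂ = 0) :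
    ‖Y (e 0)‖ ≤ ‖Y + D‖ := by
  have hDe : D (e 0) = ⟪e 0, D (e 0)⟫_ℂ • e 0 := ext_inner_basis e fun i => by
    rw [inner_smul_right, orthonormal_iff_ite.1 e.orthonormal]
    by_cases hi : i = 0
    · simp [hi]
    · simp [hi, hD i 0 hi]
  have h1 := norm_add_sq_eq_norm_sq_add_norm_sq_of_inner_eq_zero (𝕜 := ℂ) (D (e 0)) (Y (e 0))
    (by rw [hDe, inner_smul_left, hY, mul_zero])
  have h2 := (Y + D).le_opNorm (e 0)
  rw [e.orthonormal.1, mul_one, add_apply, add_comm] at h2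
  exact h2.trans' (abs_le_of_sq_le_sq (by nlinarith [norm_nonneg (D (e 0))])
    (norm_nonneg _) |>.trans' (le_abs_self _))

theorem quotientNorm_eq (e : HilbertBasis ℕ ℂ H) {Y D : H →L[ℂ] H} {M : ℝ}
    (hY : ⟪e 0, Y (e 0)⟫_ℂ = 0) (hYM : ‖Y (e 0)‖ = M) (hD : D ∈ compactSkew H)
    (hD' : ∀ i j, i ≠ j → ⟪e i, D (e j)⟫_ℂ = 0) (hM : ‖Y + D‖ ≤ M) : quotientNorm e Y = M := by
  have hlow : ∀ x ∈ {x | ∃ D ∈ compactSkew H, (∀ i j, i ≠ j → ⟪e i, D (e j)⟫_ℂ = 0) ∧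
      x = ‖Y + D‖}, M ≤ x := by
    rintro x ⟨E, -, hE, rfl⟩
    exact hYM ▸ norm_first_column_le e hY hE
  exact le_antisymm ((csInf_le ⟨M, hlow⟩ ⟨D, hD, hD', rfl⟩).trans hM)
    (le_csInf ⟨_, D, hD, hD', rfl⟩ hlow)

/-- Two lifts of the same velocity differ by an operator commuting with `b`, hence by a diagonal
one, and the first column bounds every lift from below. A sequence `D n` with errors `δ n` is
allowed because for `Y_r` the natural diagonal `D₀` is not compact and therefore not admissible. -/
theorem finslerNorm_eq (e : HilbertBasis ℕ ℂ H) {b Y : H →L[ℂ] H} {M : ℝ} {lam : ℕ → ℝ}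
    (hlam : Function.Injective lam) (hb : ∀ i, b (e i) = (lam i : ℂ) • e i)
    (hYs : Y ∈ compactSkew H) (hY : ⟪e 0, Y (e 0)⟫_ℂ = 0) (hYM : ‖Y (e 0)‖ = M)
    {D : ℕ → H →L[ℂ] H} (hD : ∀ n, D n ∈ compactSkew H)
    (hDe : ∀ n, ∃ d : ℕ → ℂ, ∀ j, D n (e j) = d j • e j) {δ : ℕ → ℝ}
    (hδ : Tendsto δ atTop (𝓝 0)) (hM : ∀ᶠ n in atTop, ‖Y + D n‖ ≤ M + δ n) :
    finslerNorm b (Y * b - b * Y) = ENNReal.ofReal M := by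
  refine le_antisymm ?_ (le_iInf₂ fun z hz => ?_)
  · have hlim : Tendsto (fun n => ENNReal.ofReal (M + δ n)) atTop (𝓝 (ENNReal.ofReal M)) :=
      (ENNReal.continuous_ofReal.tendsto _).comp (by simpa using hδ.const_add M)
    refine ge_of_tendsto hlim (hM.mono fun n hn => ?_)
    obtain ⟨d, hd⟩ := hDe n
    refine (finslerNorm_le (add_mem_compactSkew hYs (hD n)) ?_).trans ?_
    · rw [add_mul, mul_add, (commute_of_diag e hd hb).eq]
      abel
    · rw [← ofReal_norm]
      exact ENNReal.ofReal_le_ofReal hn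
  · have hcomm : (z - Y) * b = b * (z - Y) := by
      rw [sub_mul, mul_sub, sub_eq_sub_iff_sub_eq_sub]
      exact hz.2
    rw [← ofReal_norm]
    refine ENNReal.ofReal_le_ofReal ?_
    have h := norm_first_column_le e (D := z - Y) hY fun i j hij =>
      inner_eq_zero_of_commute e hlam hb hcomm hij
    rwa [hYM, add_sub_cancel] at h

end FirstColumn

section Truncations

variable {H : Type*} [NormedAddCommGroup H] [InnerProductSpace ℂ H] [CompleteSpace H]

/-! ### The truncated operators `Y_n + D_n` -/

theorem bddAbove_norm_compression (e : HilbertBasis ℕ ℂ H) {γ : ℝ} (hγ0 : γ ≠ 0) (hγ1 : |γ| < 1) :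
    BddAbove (range fun n : ℕ => ‖proj e n * opY1 e γ * proj e n + opDn e γ n‖) := by
  -- Adding `c P_n` makes the sequence converge, hence bounded; removing it costs at most `‖c‖`.
  set c : ℂ := Complex.I / (1 - (γ : ℂ))
  obtain ⟨C, hC⟩ := ((tendsto_compression_opY1 e hγ0 hγ1).add
    (tendsto_opDn_add_proj e hγ0 hγ1)).norm.bddAbove_range
  refine ⟨C + ‖c‖, ?_⟩
  rintro _ ⟨n, rfl⟩
  have h1 : ‖proj e n * opY1 e γ * proj e n + (opDn e γ n + c • proj e n)‖ ≤ C := hC ⟨n, rfl⟩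
  have h2 : proj e n * opY1 e γ * proj e n + opDn e γ n =
      proj e n * opY1 e γ * proj e n + (opDn e γ n + c • proj e n) - c • proj e n := by abel
  have h3 : ‖c • proj e n‖ ≤ ‖c‖ := by
    rw [norm_smul]
    exact mul_le_of_le_one_right (norm_nonneg _) (norm_proj_le e n)
  simp only
  rw [h2]
  exact (norm_sub_le _ _).trans (add_le_add h1 h3)

theorem M0_pos (e : HilbertBasis ℕ ℂ H) {γ : ℝ} (hγ0 : γ ≠ 0) (hγ1 : |γ| < 1) : 0 < M0 e γ := by
  refine lt_max_of_lt_right (norm_pos_iff.2 fun h => ?_)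
  -- One off-diagonal entry, `iγ`, is already nonzero, and the diagonal `D₀` cannot alter it.
  have h1 : ⟪e 1, (opY1 e γ + opD0 e γ) (e 2)⟫_ℂ = Complex.I * γ := by
    rw [add_apply, inner_add_right, opY1_spec e hγ0 hγ1, opD0_spec e hγ0 hγ1]
    simp [entryY]
  rw [h] at h1
  simp [hγ0] at h1

theorem norm_compression_le (e : HilbertBasis ℕ ℂ H) {γ : ℝ} (hγ0 : γ ≠ 0) (hγ1 : |γ| < 1)
    (n : ℕ) : ‖proj e n * opY1 e γ * proj e n + opDn e γ n‖ ≤ M0 e γ :=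
  (le_ciSup (bddAbove_norm_compression e hγ0 hγ1) n).trans (le_max_left _ _)

theorem inner_first_column (e : HilbertBasis ℕ ℂ H) {γ : ℝ} (hγ1 : |γ| < 1) (n i : ℕ) :
    ⟪e i, (proj e n * opL e γ * proj e n) (e 0)⟫_ℂ =
      if i ≠ 0 ∧ i < n then Complex.I * (γ : ℂ) ^ i else 0 := by
  rw [inner_compression, opL_spec e hγ1, zero_add, entryL_succ_one]
  by_cases hi : i = 0
  · simp [hi]
  · by_cases hn : i < n
    · simp [hi, hn, show 0 < n by omega]
    · simp [hn]

/-- A skew matrix supported on the first row and column, with zero corner, is determined by its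
first column. -/
theorem compression_opL_eq (e : HilbertBasis ℕ ℂ H) {γ : ℝ} (hγ1 : |γ| < 1) (n : ℕ) :
    proj e n * opL e γ * proj e n =
      planeSkew (e 0) ((proj e n * opL e γ * proj e n) (e 0)) 0 := by
  refine ext_entries e fun i j => ?_
  rw [planeSkew_apply, zero_apply, add_zero, inner_sub_right, inner_smul_right, inner_smul_right,
    ← inner_conj_symm ((proj e n * opL e γ * proj e n) (e 0)) (e j),
    inner_first_column e hγ1, inner_first_column e hγ1,
    inner_compression, opL_spec e hγ1, orthonormal_iff_ite.1 e.orthonormal,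
    orthonormal_iff_ite.1 e.orthonormal]
  rcases j with _ | j
  · rw [zero_add, entryL_succ_one]
    rcases i with _ | i
    · simp
    · by_cases hi : i + 1 < n
      · simp [hi, show 0 < n by omega]
      · simp [hi]
  · rcases i with _ | i
    · rw [zero_add, entryL_symm, entryL_succ_one]
      by_cases hj : j + 1 < n
      · simp [hj, show 0 < n by omega]
      · simp [hj]
    · simp [entryL_succ_succ]

theorem first_column_ne_zero (e : HilbertBasis ℕ ℂ H) {γ : ℝ} (hγ0 : γ ≠ 0) (hγ1 : |γ| < 1) {n : ℕ}
    (hn : 2 ≤ n) : (proj e n * opL e γ * proj e n) (e 0) ≠ 0 := by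
  intro h
  have h1 := inner_first_column e hγ1 n 1
  rw [h, if_pos ⟨one_ne_zero, hn⟩] at h1
  simp [hγ0] at h1

theorem opL_first_column_ne_zero (e : HilbertBasis ℕ ℂ H) {γ : ℝ} (hγ0 : γ ≠ 0) (hγ1 : |γ| < 1) :
    opL e γ (e 0) ≠ 0 := by
  intro h
  have h1 := opL_spec e hγ1 1 0
  rw [h] at h1
  simp [entryL_succ_one, hγ0] at h1

theorem first_column_eq_sum (e : HilbertBasis ℕ ℂ H) {γ : ℝ} (hγ1 : |γ| < 1) (N : ℕ) :
    (proj e (N + 1) * opL e γ * proj e (N + 1)) (e 0) =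
      ∑ j ∈ Finset.range N, (Complex.I * (γ : ℂ) ^ (j + 1)) • e (j + 1) := by
  refine ext_inner_basis e fun i => ?_
  rw [inner_first_column e hγ1, inner_sum]
  simp only [inner_smul_right, orthonormal_iff_ite.1 e.orthonormal]
  rcases i with _ | i
  · simp
  · simp [eq_comm (a := i)]

theorem inner_compression_opY1_add_opDn (e : HilbertBasis ℕ ℂ H) {γ : ℝ} (hγ0 : γ ≠ 0)
    (hγ1 : |γ| < 1) (n i j : ℕ) :
    ⟪e i, (proj e n * opY1 e γ * proj e n + opDn e γ n) (e j)⟫_ℂ = Complex.I * entryW γ n i j := by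
  rw [add_apply, inner_add_right, inner_compression, opY1_spec e hγ0 hγ1, opDn_spec, entryW]
  split_ifs <;> push_cast <;> ring

theorem compression_apply_first (e : HilbertBasis ℕ ℂ H) {γ : ℝ} (hγ0 : γ ≠ 0)
    (hγ1 : |γ| < 1) (n : ℕ) : (proj e n * opY1 e γ * proj e n) (e 0) = 0 :=
  ext_inner_basis e fun i => by
    rw [inner_compression, opY1_spec e hγ0 hγ1]
    simp [entryY]

theorem compression_add_opDn_apply_first (e : HilbertBasis ℕ ℂ H) {γ : ℝ} (hγ0 : γ ≠ 0)
    (hγ1 : |γ| < 1) (n : ℕ) : (proj e n * opY1 e γ * proj e n + opDn e γ n) (e 0) = 0 :=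
  ext_inner_basis e fun i => by
    rw [inner_compression_opY1_add_opDn e hγ0 hγ1, entryW_zero_right]
    simp

theorem compression_add_opDn_apply_column (e : HilbertBasis ℕ ℂ H) {γ : ℝ} (hγ0 : γ ≠ 0)
    (hγ1 : |γ| < 1) (n : ℕ) :
    (proj e n * opY1 e γ * proj e n + opDn e γ n) ((proj e n * opL e γ * proj e n) (e 0)) = 0 := by
  rcases n with _ | N
  · simp [proj]
  refine ext_inner_basis e fun i => ?_
  rw [first_column_eq_sum e hγ1, map_sum, inner_sum, inner_zero_right]
  simp only [map_smul, inner_smul_right, inner_compression_opY1_add_opDn e hγ0 hγ1]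
  have h := congrArg (fun x : ℝ => -(x : ℂ)) (sum_entryW_mul_pow γ N i)
  simp only [Complex.ofReal_sum, Complex.ofReal_mul, Complex.ofReal_pow, Complex.ofReal_zero,
    neg_zero, ← Finset.sum_neg_distrib] at h
  rw [← h]
  refine Finset.sum_congr rfl fun j _ => ?_
  -- The factors `i` of the matrix entry and of the column entry multiply to `-1`, which explains
  -- the negated identity in `h`.
  linear_combination (γ : ℂ) ^ (j + 1) * (entryW γ (N + 1) i (j + 1) : ℂ) * Complex.I_mul_I

theorem planeSkew_real_smul (a f : H) (W : H →L[ℂ] H) (r : ℝ) :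
    planeSkew a ((r : ℂ) • f) W = (r : ℂ) • planeSkew a f 0 + W := by
  refine ContinuousLinearMap.ext fun x => ?_
  simp only [planeSkew_apply, add_apply, smul_apply, zero_apply, inner_smul_left,
    Complex.conj_ofReal]
  module

/-- The ratio `r_n` between the first column of `Y_n` and that of `P_n L P_n`. -/
noncomputable def ratio (e : HilbertBasis ℕ ℂ H) (γ : ℝ) (n : ℕ) : ℝ :=
  M0 e γ / firstColNorm e (proj e n * opL e γ * proj e n)

theorem opYn_add_opDn_eq (e : HilbertBasis ℕ ℂ H) {γ : ℝ} (hγ1 : |γ| < 1) (n : ℕ) :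
    opYn e γ n + opDn e γ n = planeSkew (e 0)
      ((ratio e γ n : ℂ) • (proj e n * opL e γ * proj e n) (e 0))
      (proj e n * opY1 e γ * proj e n + opDn e γ n) := by
  rw [planeSkew_real_smul, ← compression_opL_eq e hγ1, opYn, ratio, add_assoc]

theorem norm_ratio_smul (e : HilbertBasis ℕ ℂ H) {γ : ℝ} (hγ0 : γ ≠ 0) (hγ1 : |γ| < 1) {n : ℕ}
    (hn : 2 ≤ n) :
    ‖(ratio e γ n : ℂ) • (proj e n * opL e γ * proj e n) (e 0)‖ = M0 e γ := by
  have h := norm_pos_iff.2 (first_column_ne_zero e hγ0 hγ1 hn)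
  rw [norm_smul, Complex.norm_real, ratio, firstColNorm, norm_div, norm_norm,
    Real.norm_of_nonneg (M0_pos e hγ0 hγ1).le, div_mul_cancel₀ _ h.ne']

theorem inner_first_column_zero (e : HilbertBasis ℕ ℂ H) {γ : ℝ} (hγ1 : |γ| < 1) (n : ℕ) (c : ℂ) :
    ⟪e 0, c • (proj e n * opL e γ * proj e n) (e 0)⟫_ℂ = 0 := by
  rw [inner_smul_right, inner_first_column e hγ1]
  simp

theorem opYn_apply_first (e : HilbertBasis ℕ ℂ H) {γ : ℝ} (hγ0 : γ ≠ 0) (hγ1 : |γ| < 1) (n : ℕ) :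
    opYn e γ n (e 0) = (ratio e γ n : ℂ) • (proj e n * opL e γ * proj e n) (e 0) := by
  rw [opYn, add_apply, compression_apply_first e hγ0 hγ1, add_zero, smul_apply, ratio]

theorem opYn_mem_compactSkew (e : HilbertBasis ℕ ℂ H) {γ : ℝ} (hγ0 : γ ≠ 0) (hγ1 : |γ| < 1)
    (n : ℕ) : opYn e γ n ∈ compactSkew H :=
  add_mem_compactSkew (real_smul_mem_compactSkew _
    ⟨isCompactOperator_compression e _ n, star_compression e (star_opL e hγ1) n⟩)
    ⟨isCompactOperator_compression e _ n, star_compression e (star_opY1 e hγ0 hγ1) n⟩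

theorem norm_opYn_add_opDn_le (e : HilbertBasis ℕ ℂ H) {γ : ℝ} (hγ0 : γ ≠ 0) (hγ1 : |γ| < 1)
    {n : ℕ} (hn : 2 ≤ n) : ‖opYn e γ n + opDn e γ n‖ ≤ M0 e γ := by
  rw [opYn_add_opDn_eq e hγ1]
  refine norm_planeSkew_le (M0_pos e hγ0 hγ1) (e.orthonormal.1 0) (norm_ratio_smul e hγ0 hγ1 hn)
    (inner_first_column_zero e hγ1 n _) ?_ (compression_add_opDn_apply_first e hγ0 hγ1 n) ?_
    (norm_compression_le e hγ0 hγ1 n)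
  · rw [star_add, star_compression e (star_opY1 e hγ0 hγ1), star_opDn, neg_add]
  · rw [map_smul, compression_add_opDn_apply_column e hγ0 hγ1, smul_zero]

theorem inner_exp_opYn_add_opDn (e : HilbertBasis ℕ ℂ H) {γ : ℝ} (hγ0 : γ ≠ 0) (hγ1 : |γ| < 1)
    {n : ℕ} (hn : 2 ≤ n) (t : ℝ) :
    ⟪e 0, NormedSpace.exp ((t : ℂ) • (opYn e γ n + opDn e γ n)) (e 0)⟫_ℂ =
      Real.cos (t * M0 e γ) := by
  rw [opYn_add_opDn_eq e hγ1]
  refine inner_exp_planeSkew (M0_pos e hγ0 hγ1) (e.orthonormal.1 0) (norm_ratio_smul e hγ0 hγ1 hn)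
    (inner_first_column_zero e hγ1 n _) (compression_add_opDn_apply_first e hγ0 hγ1 n) ?_ t
  rw [map_smul, compression_add_opDn_apply_column e hγ0 hγ1, smul_zero]

theorem commute_proj_opYn_add_opDn (e : HilbertBasis ℕ ℂ H) (γ : ℝ) (n : ℕ) :
    Commute (proj e n) (opYn e γ n + opDn e γ n) :=
  (((commute_proj_compression e _ n).smul_right _).add_right
    (commute_proj_compression e _ n)).add_right
    (commute_of_diag e (proj_basis e n) (opDn_basis e γ n))

/-! ### Limits as the size of the truncations grows -/

theorem tendsto_opYn (e : HilbertBasis ℕ ℂ H) {γ : ℝ} (hγ0 : γ ≠ 0) (hγ1 : |γ| < 1) :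
    Tendsto (opYn e γ) atTop (𝓝 (opYr e γ)) := by
  have hL := tendsto_compression_opL e hγ1
  have h1 : Tendsto (fun n => firstColNorm e (proj e n * opL e γ * proj e n)) atTop
      (𝓝 (firstColNorm e (opL e γ))) :=
    (((ContinuousLinearMap.apply ℂ H (e 0)).continuous.tendsto _).comp hL).norm
  have h2 := (tendsto_const_nhds (x := M0 e γ)).div h1 (norm_ne_zero_iff.2 (opL_first_column_ne_zero e hγ0 hγ1))
  exact (((Complex.continuous_ofReal.tendsto _).comp h2).smul hL).add
    (tendsto_compression_opY1 e hγ0 hγ1)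

theorem opYr_mem_compactSkew (e : HilbertBasis ℕ ℂ H) {γ : ℝ} (hγ0 : γ ≠ 0) (hγ1 : |γ| < 1) :
    opYr e γ ∈ compactSkew H :=
  add_mem_compactSkew (real_smul_mem_compactSkew _
    ⟨isCompactOperator_of_tendsto (tendsto_compression_opL e hγ1)
      (Eventually.of_forall fun n => isCompactOperator_compression e _ n), star_opL e hγ1⟩)
    ⟨isCompactOperator_of_tendsto (tendsto_compression_opY1 e hγ0 hγ1)
      (Eventually.of_forall fun n => isCompactOperator_compression e _ n), star_opY1 e hγ0 hγ1⟩

theorem opYr_apply_first (e : HilbertBasis ℕ ℂ H) {γ : ℝ} (hγ0 : γ ≠ 0) (hγ1 : |γ| < 1) :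
    ⟪e 0, opYr e γ (e 0)⟫_ℂ = 0 ∧ ‖opYr e γ (e 0)‖ = M0 e γ := by
  have h1 : opY1 e γ (e 0) = 0 := ext_inner_basis e fun i => by
    rw [opY1_spec e hγ0 hγ1]
    simp [entryY]
  have h2 := norm_pos_iff.2 (opL_first_column_ne_zero e hγ0 hγ1)
  rw [opYr, add_apply, h1, add_zero, smul_apply]
  constructor
  · rw [inner_smul_right, opL_spec e hγ1, zero_add, entryL_succ_one]
    simp
  · rw [norm_smul, Complex.norm_real, firstColNorm, norm_div, norm_norm,
      Real.norm_of_nonneg (M0_pos e hγ0 hγ1).le, div_mul_cancel₀ _ h2.ne']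

theorem finslerNorm_opYn (e : HilbertBasis ℕ ℂ H) {γ : ℝ} (hγ0 : γ ≠ 0) (hγ1 : |γ| < 1)
    {lam : ℕ → ℝ} (hlam : Function.Injective lam) {b : H →L[ℂ] H}
    (hb : ∀ i, b (e i) = (lam i : ℂ) • e i) {n : ℕ} (hn : 2 ≤ n) :
    finslerNorm b (opYn e γ n * b - b * opYn e γ n) = ENNReal.ofReal (M0 e γ) := by
  have h := opYn_apply_first e hγ0 hγ1 n
  refine finslerNorm_eq e hlam hb (opYn_mem_compactSkew e hγ0 hγ1 n)
    (by rw [h, inner_first_column_zero e hγ1]) (by rw [h, norm_ratio_smul e hγ0 hγ1 hn])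
    (D := fun _ => opDn e γ n) (fun _ => opDn_mem_compactSkew e γ n)
    (fun _ => ⟨_, opDn_basis e γ n⟩) (tendsto_const_nhds (x := (0 : ℝ)))
    (Eventually.of_forall fun _ => ?_)
  rw [add_zero]
  exact norm_opYn_add_opDn_le e hγ0 hγ1 hn

theorem finslerNorm_opYr (e : HilbertBasis ℕ ℂ H) {γ : ℝ} (hγ0 : γ ≠ 0) (hγ1 : |γ| < 1)
    {lam : ℕ → ℝ} (hlam : Function.Injective lam) {b : H →L[ℂ] H}
    (hb : ∀ i, b (e i) = (lam i : ℂ) • e i) :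
    finslerNorm b (opYr e γ * b - b * opYr e γ) = ENNReal.ofReal (M0 e γ) := by
  refine finslerNorm_eq e hlam hb (opYr_mem_compactSkew e hγ0 hγ1)
    (opYr_apply_first e hγ0 hγ1).1 (opYr_apply_first e hγ0 hγ1).2
    (D := opDn e γ) (fun n => opDn_mem_compactSkew e γ n) (fun n => ⟨_, opDn_basis e γ n⟩)
    (tendsto_iff_norm_sub_tendsto_zero.1 (tendsto_opYn e hγ0 hγ1)) ?_
  filter_upwards [eventually_ge_atTop 2] with n hn
  -- `Y_r + D_n` is compared with `Y_n + D_n`, whose norm is at most `M₀`; the error is `‖Y_n -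
  -- Y_r‖`.
  have h1 : opYr e γ + opDn e γ n = (opYn e γ n + opDn e γ n) - (opYn e γ n - opYr e γ) := by abel
  rw [h1]
  exact (norm_sub_le _ _).trans (by gcongr; exact norm_opYn_add_opDn_le e hγ0 hγ1 hn)

/-! ### The curves -/

theorem sigmaN_eq (e : HilbertBasis ℕ ℂ H) (γ : ℝ) {lam : ℕ → ℝ} {b : H →L[ℂ] H}
    (hb : ∀ i, b (e i) = (lam i : ℂ) • e i) (n : ℕ) :
    sigmaN e γ b n = conjCurve (opYn e γ n + opDn e γ n) b :=
  conjCurve_add_of_commute ((commute_proj_opYn_add_opDn e γ n).symm.smul_right _)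
    ((commute_of_diag e (proj_basis e n) hb).smul_left _)

theorem commutator_add_of_commute {Y D b : H →L[ℂ] H} (h : Commute D b) :
    (Y + D) * b - b * (Y + D) = Y * b - b * Y := by
  rw [add_mul, mul_add, h.eq]
  abel

theorem hasDerivAt_conjCurve_zero (Z b : H →L[ℂ] H) :
    HasDerivAt (conjCurve Z b) (Z * b - b * Z) 0 := by
  simpa using hasDerivAt_conjCurve Z b 0

/-- Joint continuity in generator and time, with time in a compact set, gives uniformity. -/
theorem tendstoUniformlyOn_conjCurve {X : ℕ → H →L[ℂ] H} {X₀ : H →L[ℂ] H}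
    (hX : Tendsto X atTop (𝓝 X₀)) (b : H →L[ℂ] H) {K : Set ℝ} (hK : IsCompact K) :
    TendstoUniformlyOn (fun n => conjCurve (X n) b) (conjCurve X₀ b) atTop K := by
  intro U hU
  obtain ⟨v, hv, h⟩ := hK.mem_uniformity_of_prod (s := univ) (q := X₀)
    (f := fun X t => conjCurve X b t) (continuous_conjCurve_uncurry b).continuousOn (mem_univ _)
    (UniformSpace.symm hU)
  rw [nhdsWithin_univ] at hv
  filter_upwards [hX hv] with n hn t ht
  exact h _ hn t ht

theorem arccos_two_mul_cos_sq {x : ℝ} (hx : |x| ≤ Real.pi / 2) :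
    Real.arccos (2 * ‖((Real.cos x : ℝ) : ℂ)‖ ^ 2 - 1) / 2 = |x| := by
  rw [Complex.norm_real, Real.norm_eq_abs, sq_abs, ← Real.cos_two_mul, ← Real.cos_abs,
    abs_mul, abs_two, Real.arccos_cos (by positivity) (by linarith)]
  ring

theorem isMinimalLengthCurve_opYn (e : HilbertBasis ℕ ℂ H) {γ : ℝ} (hγ0 : γ ≠ 0) (hγ1 : |γ| < 1)
    {lam : ℕ → ℝ} (hlam : Function.Injective lam) {A b u : H →L[ℂ] H}
    (hb : ∀ i, b (e i) = (lam i : ℂ) • e i) (hu : u ∈ fredholmUnitary H)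
    (hA : A = u * b * star u) {n : ℕ} (hn : 2 ≤ n) {t : ℝ}
    (ht : |t * M0 e γ| ≤ Real.pi / 2) :
    IsMinimalLengthCurve A (conjCurve (opYn e γ n + opDn e γ n) b) t := by
  have hZ := add_mem_compactSkew (opYn_mem_compactSkew e hγ0 hγ1 n) (opDn_mem_compactSkew e γ n)
  have hM := M0_pos e hγ0 hγ1
  refine ⟨isSmoothCurve_conjCurve hu hA hZ _, ?_⟩
  have hlen : curveLength (conjCurve (opYn e γ n + opDn e γ n) b) (uIcc 0 t) =
      ENNReal.ofReal (|t| * M0 e γ) := by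
    rw [curveLength_conjCurve_uIcc hZ.2, commutator_add_of_commute
      (commute_of_diag e (opDn_basis e γ n) hb), finslerNorm_opYn e hγ0 hγ1 hlam hb hn,
      ← ENNReal.ofReal_mul hM.le, mul_comm]
  rw [hlen, conjCurve_zero]
  refine le_antisymm ?_ ((rectDist_conjCurve_le hu hA hZ t).trans (ENNReal.ofReal_le_ofReal
    (mul_le_mul_of_nonneg_left (norm_opYn_add_opDn_le e hγ0 hγ1 hn) (abs_nonneg t))))
  -- Any competitor joins `b` to its conjugate by `exp(tZ)`, so the angle bound applies with the
  -- eigenvector `e₀`; there the angle is exactly `|t| M₀`.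
  refine le_iInf fun s => le_iInf fun s' => le_iInf fun χ => le_iInf fun h => ?_
  obtain ⟨hs, hχ, h0, h1⟩ := h
  rw [conjCurve_eq hZ.2] at h1
  have h2 := le_curveLength e hlam hb hu hA (exp_smul_mem_unitary hZ.2 t) 0 hs hχ h0 h1
  rwa [inner_exp_opYn_add_opDn e hγ0 hγ1 hn, arccos_two_mul_cos_sq ht, abs_mul,
    abs_of_pos hM] at h2

end Truncations

end UnitaryOrbit

/-! ### Lengths, minimality and convergence of the approximating curves -/

theorem mainTheorem2 {H : Type*} [NormedAddCommGroup H] [InnerProductSpace ℂ H] [CompleteSpace H]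
    (e : HilbertBasis ℕ ℂ H) (γ : ℝ) (hγ0 : γ ≠ 0) (hγ1 : |γ| < 1)
    (lam : ℕ → ℝ) (hlam : Function.Injective lam)
    (A b u : H →L[ℂ] H) (hA : IsCompactOperator A)
    (hb : ∀ i, b (e i) = (lam i : ℂ) • e i)
    (hu : u ∈ fredholmUnitary H) (hAb : A = u * b * star u) :
    -- the constant `M₀` is a genuine maximum of finite quantities, and positive
    (BddAbove (range fun n : ℕ => ‖proj e n * opY1 e γ * proj e n + opDn e γ n‖) ∧ 0 < M0 e γ) ∧
    -- (1) initial point and initial velocity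
    (∀ n, sigmaN e γ b n 0 = b ∧
      HasDerivAt (sigmaN e γ b n) (opYn e γ n * b - b * opYn e γ n) 0 ∧
      opYn e γ n * b - b * opYn e γ n ∈ tangentSpace b) ∧
    -- (2) the projection term may be dropped
    (∀ n, Commute (proj e n) (opYn e γ n + opDn e γ n) ∧
      ∀ t : ℝ, sigmaN e γ b n t = conjCurve (opYn e γ n + opDn e γ n) b t) ∧
    -- (3) lengths
    (∀ n, 2 ≤ n → quotientNorm e (opYn e γ n) = M0 e γ ∧
      ∀ t₀ ∈ Icc (-(Real.pi / (2 * M0 e γ))) (Real.pi / (2 * M0 e γ)),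
        curveLength (sigmaN e γ b n) (uIcc 0 t₀) =
          ENNReal.ofReal (|t₀| * quotientNorm e (opYn e γ n)) ∧
        curveLength (sigmaN e γ b n) (uIcc 0 t₀) = ENNReal.ofReal (|t₀| * M0 e γ) ∧
        curveLength (sigmaN e γ b n) (uIcc 0 t₀) = curveLength (sigma e γ b) (uIcc 0 t₀)) ∧
    -- (4) minimality
    (∀ n, 2 ≤ n → (∀ t, deriv (sigmaN e γ b n) t ≠ 0) ∧
      ∀ t₀ ∈ Icc (-(Real.pi / (2 * M0 e γ))) (Real.pi / (2 * M0 e γ)),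
        IsMinimalLengthCurve A (sigmaN e γ b n) t₀) ∧
    -- (5) convergence of the initial velocities in the Finsler norm at `b`
    (HasDerivAt (sigma e γ b) (opYr e γ * b - b * opYr e γ) 0 ∧
      Tendsto (fun n => finslerNorm b (deriv (sigmaN e γ b n) 0 - deriv (sigma e γ b) 0))
        atTop (𝓝 0)) ∧
    -- uniform convergence of the curves in the operator norm
    TendstoUniformlyOn (sigmaN e γ b) (sigma e γ b) atTop
      (Icc (-(Real.pi / (2 * M0 e γ))) (Real.pi / (2 * M0 e γ))) := by

  have hM := M0_pos e hγ0 hγ1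
  have hDnb (n : ℕ) : Commute (opDn e γ n) b := commute_of_diag e (opDn_basis e γ n) hb
  have hD0b : Commute (opD0 e γ) b := commute_of_diag e (opD0_basis e hγ0 hγ1) hb
  have hYn := opYn_mem_compactSkew e hγ0 hγ1
  have hZn (n : ℕ) := add_mem_compactSkew (hYn n) (opDn_mem_compactSkew e γ n)
  have hYr := opYr_mem_compactSkew e hγ0 hγ1
  have hder (n : ℕ) : HasDerivAt (sigmaN e γ b n) (opYn e γ n * b - b * opYn e γ n) 0 := by
    rw [sigmaN_eq e γ hb, ← commutator_add_of_commute (hDnb n)]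
    exact hasDerivAt_conjCurve_zero _ b
  have hder' : HasDerivAt (sigma e γ b) (opYr e γ * b - b * opYr e γ) 0 := by
    rw [← commutator_add_of_commute hD0b]
    exact hasDerivAt_conjCurve_zero _ b
  have hlen {n : ℕ} (hn : 2 ≤ n) (t : ℝ) :
      curveLength (sigmaN e γ b n) (uIcc 0 t) = ENNReal.ofReal (|t| * M0 e γ) := by
    rw [sigmaN_eq e γ hb, curveLength_conjCurve_uIcc (hZn n).2, commutator_add_of_commute (hDnb n),
      finslerNorm_opYn e hγ0 hγ1 hlam hb hn, ← ENNReal.ofReal_mul hM.le, mul_comm]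
  have hlen' (t : ℝ) : curveLength (sigma e γ b) (uIcc 0 t) = ENNReal.ofReal (|t| * M0 e γ) := by
    have hZ : star (opYr e γ + opD0 e γ) = -(opYr e γ + opD0 e γ) := by
      rw [star_add, hYr.2, star_opD0 e hγ0 hγ1, neg_add]
    rw [sigma, curveLength_conjCurve_uIcc hZ, commutator_add_of_commute hD0b,
      finslerNorm_opYr e hγ0 hγ1 hlam hb, ← ENNReal.ofReal_mul hM.le, mul_comm]
  have hquot {n : ℕ} (hn : 2 ≤ n) : quotientNorm e (opYn e γ n) = M0 e γ := by
    have h := opYn_apply_first e hγ0 hγ1 n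
    exact quotientNorm_eq e (by rw [h, inner_first_column_zero e hγ1])
      (by rw [h, norm_ratio_smul e hγ0 hγ1 hn]) (opDn_mem_compactSkew e γ n)
      (fun i j hij => opDn_offDiag e γ n hij) (norm_opYn_add_opDn_le e hγ0 hγ1 hn)
  refine ⟨⟨bddAbove_norm_compression e hγ0 hγ1, hM⟩, fun n => ⟨?_, hder n, _, hYn n, rfl⟩,
    fun n => ⟨commute_proj_opYn_add_opDn e γ n, fun t => by rw [sigmaN_eq e γ hb]⟩,
    fun n hn => ⟨hquot hn, fun t _ => ⟨?_, hlen hn t, ?_⟩⟩, fun n hn => ⟨fun t h0 => ?_,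
    fun t ht => ?_⟩, ⟨hder', ?_⟩, ?_⟩
  · rw [sigmaN_eq e γ hb, conjCurve_zero]
  · rw [hlen hn, hquot hn]
  · rw [hlen hn, hlen']
  · rw [sigmaN_eq e γ hb] at h0
    have h := finslerNorm_deriv_conjCurve (hZn n).2 b t
    rw [commutator_add_of_commute (hDnb n), finslerNorm_opYn e hγ0 hγ1 hlam hb hn, h0] at h
    -- The zero vector has Finsler norm `0`, whereas the velocity has norm `M₀ > 0`.
    have h1 := finslerNorm_le (b := conjCurve (opYn e γ n + opDn e γ n) b t)
      (z := 0) (x := 0) (by simpa using real_smul_mem_compactSkew 0 (hZn n)) (by simp)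
    rw [h, enorm_zero, nonpos_iff_eq_zero, ENNReal.ofReal_eq_zero] at h1
    exact h1.not_gt hM
  · rw [sigmaN_eq e γ hb]
    refine isMinimalLengthCurve_opYn e hγ0 hγ1 hlam hb hu hAb hn ?_
    rw [abs_mul, abs_of_pos hM]
    have h1 := mul_le_mul_of_nonneg_right (abs_le.2 ht) hM.le
    refine h1.trans_eq ?_
    field_simp
  · have h1 : Tendsto (fun n => ‖opYn e γ n - opYr e γ‖ₑ) atTop (𝓝 0) := by
      have h2 := (tendsto_opYn e hγ0 hγ1).sub_const (opYr e γ)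
      rw [sub_self] at h2
      simpa using h2.enorm
    refine tendsto_of_tendsto_of_tendsto_of_le_of_le tendsto_const_nhds h1 (fun _ => zero_le)
      fun n => ?_
    simp only
    rw [(hder n).deriv, hder'.deriv]
    -- The difference of the velocities is `[Y_n - Y_r, b]`, so `Y_n - Y_r` is an admissible lift.
    refine finslerNorm_le (sub_mem_compactSkew (hYn n) hYr) ?_
    noncomm_ring
  · have hX := (tendsto_opYn e hγ0 hγ1).add (tendsto_opDn_add_proj e hγ0 hγ1)
    have h := tendstoUniformlyOn_conjCurve hX b
      (isCompact_Icc (a := -(Real.pi / (2 * M0 e γ))) (b := Real.pi / (2 * M0 e γ)))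
    -- The norm limit of the generators `X_n` is `Y_r + D₀` plus a scalar, and the scalar does not
    -- change the curve.
    have hs : sigma e γ b = conjCurve
        (opYr e γ + (opD0 e γ + (Complex.I / (1 - (γ : ℂ))) • 1)) b := by
      rw [← add_assoc, sigma, conjCurve_add_of_commute (Z := opYr e γ + opD0 e γ) ((Commute.one_right _).smul_right _)
        ((Commute.one_left _).smul_left _)]
    rw [hs]
    simp only [← add_assoc] at h ⊢
    exact h
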